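/- All Hilbert spaces are nonzero finite-dimensional complex Hilbert spaces. A channel $\Phi$ from $\mathcal H$ to $\mathcal K$ is a completely positive and trace preserving linear map from the operators on $\mathcal H$ to the operators on $\mathcal K$. A linear map $\Phi$ from the operators on $\mathcal H$ to themselves is random unitary if there are finitely many unitary operators $U_1,\dots,U_n$ on $\mathcal H$ and a probability distribution $p_1,\dots,p_n$ with $\Phi(X)=\sum_{i=1}^n p_i U_i X U_i^*$ for all $X$; every such map is a channel. For a channel $\Phi$ from $\mathcal H$ to $\mathcal K$ let $S_{\min}(\Phi)=\min_\rho S(\Phi(\rho))$, where $\rho$ runs over the density operators on $\mathcal H$ (positive semidefinite, trace one) and $S(\sigma)=-\operatorname{tr}(\sigma\log\sigma)$ is the von Neumann entropy. Then the following two statements are equivalent: 1. $S_{\min}(\Phi\otimes\Psi)=S_{\min}(\Phi)+S_{\min}(\Psi)$ for all channels $\Phi$ and $\Psi$ (with arbitrary, possibly different, input and output spaces). 2. $S_{\min}(\Phi\otimes\Phi)=2\,S_{\min}(\Phi)$ for all random unitary channels $\Phi$. -/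

import Mathlib

open scoped Kronecker ComplexOrder

namespace QuantumChannel

/- Operators on the Hilbert space `ℂ^ι` (`ι` a finite index set of an orthonormal basis) are the
matrices `Matrix ι ι ℂ`; the space `ℂ^ι ⊗ ℂ^ι'` is `ℂ^(ι × ι')`. -/

/-- `ρ` is a density operator (mixed state): positive semidefinite with unit trace. -/
def IsDensity {ι : Type*} [Fintype ι] (ρ : Matrix ι ι ℂ) : Prop :=
  ρ.PosSemidef ∧ ρ.trace = 1

/-- The tensor product `Φ ⊗ Ψ` of two linear maps between operator spaces, acting on operators
of the tensor product space. -/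
noncomputable def tensor {ι κ ι' κ' : Type*} [Fintype ι] [DecidableEq ι] [Fintype κ]
    [DecidableEq κ] [Fintype ι'] [DecidableEq ι'] [Fintype κ'] [DecidableEq κ']
    (Φ : Matrix ι ι ℂ →ₗ[ℂ] Matrix κ κ ℂ) (Ψ : Matrix ι' ι' ℂ →ₗ[ℂ] Matrix κ' κ' ℂ) :
    Matrix (ι × ι') (ι × ι') ℂ →ₗ[ℂ] Matrix (κ × κ') (κ × κ') ℂ :=
  (kroneckerLinearEquiv κ κ κ' κ' ℂ).toLinearMap ∘ₗ TensorProduct.map Φ Ψ ∘ₗ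
    (kroneckerLinearEquiv ι ι ι' ι' ℂ).symm.toLinearMap

/-- `Φ ⊗ Ψ` is determined by its action on product operators. -/
theorem tensor_kronecker {ι κ ι' κ' : Type*} [Fintype ι] [DecidableEq ι] [Fintype κ]
    [DecidableEq κ] [Fintype ι'] [DecidableEq ι'] [Fintype κ'] [DecidableEq κ']
    (Φ : Matrix ι ι ℂ →ₗ[ℂ] Matrix κ κ ℂ) (Ψ : Matrix ι' ι' ℂ →ₗ[ℂ] Matrix κ' κ' ℂ)
    (X : Matrix ι ι ℂ) (Y : Matrix ι' ι' ℂ) :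
    tensor Φ Ψ (X ⊗ₖ Y) = Φ X ⊗ₖ Ψ Y := by
  simp [tensor]

/-- `Φ` is completely positive: `id_n ⊗ Φ` preserves positive semidefiniteness for every `n`. -/
def IsCompletelyPositive {ι κ : Type*} [Fintype ι] [DecidableEq ι] [Fintype κ] [DecidableEq κ]
    (Φ : Matrix ι ι ℂ →ₗ[ℂ] Matrix κ κ ℂ) : Prop :=
  ∀ (n : ℕ) (X : Matrix (Fin n × ι) (Fin n × ι) ℂ), X.PosSemidef →
    (tensor (LinearMap.id : Matrix (Fin n) (Fin n) ℂ →ₗ[ℂ] Matrix (Fin n) (Fin n) ℂ) Φ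
      X).PosSemidef

/-- A channel is a completely positive and trace preserving linear map. -/
def IsChannel {ι κ : Type*} [Fintype ι] [DecidableEq ι] [Fintype κ] [DecidableEq κ]
    (Φ : Matrix ι ι ℂ →ₗ[ℂ] Matrix κ κ ℂ) : Prop :=
  IsCompletelyPositive Φ ∧ ∀ X, (Φ X).trace = X.trace

/-- `Φ` is random unitary: `Φ(X) = ∑ i, p i • U i X (U i)*` for finitely many unitary operators
`U i` and a probability distribution `p`. -/
def IsRandomUnitary {ι : Type*} [Fintype ι] [DecidableEq ι]
    (Φ : Matrix ι ι ℂ →ₗ[ℂ] Matrix ι ι ℂ) : Prop :=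
  ∃ (n : ℕ) (U : Fin n → Matrix ι ι ℂ) (p : Fin n → ℝ),
    (∀ i, U i ∈ Matrix.unitaryGroup ι ℂ) ∧ (∀ i, 0 ≤ p i) ∧ ∑ i, p i = 1 ∧
      ∀ X, Φ X = ∑ i, (p i : ℂ) • (U i * X * (U i).conjTranspose)

/-- The von Neumann entropy `S(ρ) = - tr (ρ log ρ)` (natural logarithm, `0 log 0 = 0`);
`cfc Real.log ρ` is the logarithm of the Hermitian matrix `ρ` by functional calculus. -/
noncomputable def entropy {ι : Type*} [Fintype ι] [DecidableEq ι] (ρ : Matrix ι ι ℂ) : ℝ :=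
  -(ρ * cfc Real.log ρ).trace.re

/-- For Hermitian `ρ` with eigenvalues `λ i`, `S(ρ) = ∑ i, - λ i log (λ i)`. -/
theorem entropy_eq_sum {ι : Type*} [Fintype ι] [DecidableEq ι] {ρ : Matrix ι ι ℂ}
    (h : ρ.IsHermitian) : entropy ρ = ∑ i, Real.negMulLog (h.eigenvalues i) := by
  have hspec := h.spectral_theorem
  have hcfc := h.cfc_eq Real.log
  rw [Matrix.IsHermitian.cfc] at hcfc
  have key : ρ * cfc Real.log ρ = Unitary.conjStarAlgAut ℂ _ h.eigenvectorUnitary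
      (Matrix.diagonal fun i => ((h.eigenvalues i * Real.log (h.eigenvalues i) : ℝ) : ℂ)) := by
    rw [hcfc]
    refine (congrArg (· * _) hspec).trans ?_
    rw [← map_mul, Matrix.diagonal_mul_diagonal]
    simp
  rw [entropy, key, Unitary.conjStarAlgAut_apply, Matrix.trace_mul_comm, ← mul_assoc]
  simp [Matrix.trace_diagonal, Real.negMulLog]

/-- The minimum output entropy `S_min(Φ) = min S(Φ(ρ))` over all density operators `ρ`. -/
noncomputable def minOutputEntropy {ι κ : Type*} [Fintype ι] [DecidableEq ι] [Fintype κ]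
    [DecidableEq κ] (Φ : Matrix ι ι ℂ →ₗ[ℂ] Matrix κ κ ℂ) : ℝ :=
  sInf {s : ℝ | ∃ ρ : Matrix ι ι ℂ, IsDensity ρ ∧ s = entropy (Φ ρ)}

end QuantumChannel

set_option linter.unusedSectionVars false

/-! Product inputs always give subadditivity of the minimum output entropy, so only superadditivity
is at stake. Two constructions reduce it to squares of random unitary channels. Each builds a
channel Ω with two properties: concavity of entropy bounds S_min(Ω) from below, and Ω ⊗ Ω restricted
to a suitable subspace is the original tensor product with fixed states attached
(`minOutputEntropy_tensor_le_of_comp`).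

From pairs to squares (`superadditive_of_equal_pairs`): for nearly optimal inputs ρ of Φ and σ of Ψ,
put Ω(X) = Φ(X₁₁) ⊗ Ψ(σ) + Φ(ρ) ⊗ Ψ(X₂₂). Then S_min(Ω) ≥ S_min(Φ) + S_min(Ψ). Feeding the first
block to one copy and the second block to the other gives S_min(Ω ⊗ Ω) ≤ S_min(Φ ⊗ Ψ) + S(Φ(ρ)) +
S(Ψ(σ)). Superadditivity for Ω ⊗ Ω now yields the claim up to ε.

From channels to random unitaries (`superadditive_of_randomUnitary`): write Φ(X) = tr_E(V X V*) with
V an isometry, and adjoin an ancilla β. Measure P = V V*; dephase β on success and depolarize it on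
failure; then depolarize E. The success branches output states Φ(·) ⊗ 1/|E| ⊗ |b⟩⟨b|, and the
failure branch has entropy at least log |E| + log |β|. If log |β| ≥ S_min(Φ), this gives S_min(Ω) ≥
S_min(Φ) + log |E|. Inputs V X V* ⊗ |b⟩⟨b| always succeed, so S_min(Ω ⊗ Ω) ≤ S_min(Φ ⊗ Φ) + 2 log
|E|, and the logarithms cancel. -/

namespace QuantumChannel

open Matrix Real

/-! ### Von Neumann entropy: spectra, tensor products and concavity. -/

section Entropy

variable {ι κ : Type*} [Fintype ι] [DecidableEq ι] [Fintype κ] [DecidableEq κ]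

theorem isHermitian_diagonal_ofReal (d : ι → ℝ) :
    (diagonal fun i => (d i : ℂ)).IsHermitian := by
  simp [Matrix.IsHermitian, diagonal_conjTranspose]

/-- A positive semidefinite matrix is unitarily diagonalizable with nonnegative eigenvalues. -/
theorem _root_.Matrix.PosSemidef.exists_unitary_diagonal {A : Matrix ι ι ℂ} (hA : A.PosSemidef) :
    ∃ W ∈ unitaryGroup ι ℂ, ∃ d : ι → ℝ, (∀ i, 0 ≤ d i) ∧
      A = W * (diagonal fun i => (d i : ℂ)) * Wᴴ := by
  refine ⟨hA.1.eigenvectorUnitary, hA.1.eigenvectorUnitary.2, hA.1.eigenvalues,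
    hA.eigenvalues_nonneg, ?_⟩
  exact hA.1.spectral_theorem

/-- The characteristic polynomial determines the multiset of diagonal entries, so any unitary
diagonalization may stand in for the chosen `eigenvalues`. -/
theorem entropy_conj_diagonal {W : Matrix ι ι ℂ} (hW : W ∈ unitaryGroup ι ℂ) (d : ι → ℝ) :
    entropy (W * (diagonal fun i => (d i : ℂ)) * Wᴴ) = ∑ i, negMulLog (d i) := by
  have hH : (W * (diagonal fun i => (d i : ℂ)) * Wᴴ).IsHermitian :=
    isHermitian_mul_mul_conjTranspose W (isHermitian_diagonal_ofReal d)
  have h1 := hH.roots_charpoly_eq_eigenvalues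
  have h2 : (W * (diagonal fun i => (d i : ℂ)) * Wᴴ).charpoly =
      (Finset.univ.val.map fun i => (Polynomial.X - Polynomial.C (d i : ℂ))).prod := by
    have hU : Wᴴ * W = 1 := mem_unitaryGroup_iff'.1 hW
    rw [mul_assoc, charpoly_mul_comm, mul_assoc, hU, mul_one, charpoly_diagonal]
    rfl
  have h3 : (W * (diagonal fun i => (d i : ℂ)) * Wᴴ).charpoly.roots =
      Finset.univ.val.map fun i => (d i : ℂ) := by
    rw [h2]
    simpa using Polynomial.roots_multiset_prod_X_sub_C (Finset.univ.val.map fun i => (d i : ℂ))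
  rw [h3] at h1
  have h4 := congrArg (fun s => (s.map fun z : ℂ => negMulLog z.re).sum) h1
  simp only [Multiset.map_map] at h4
  rw [entropy_eq_sum hH]
  exact h4.symm

theorem entropy_diagonal (d : ι → ℝ) :
    entropy (diagonal fun i => (d i : ℂ)) = ∑ i, negMulLog (d i) := by
  simpa using entropy_conj_diagonal (one_mem (unitaryGroup ι ℂ)) d

/-- A density operator is unitarily diagonalizable, its eigenvalues forming a probability
distribution. -/
theorem IsDensity.exists_unitary_diagonal {A : Matrix ι ι ℂ} (hA : IsDensity A) :
    ∃ W ∈ unitaryGroup ι ℂ, ∃ d : ι → ℝ, (∀ i, 0 ≤ d i) ∧ ∑ i, d i = 1 ∧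
      A = W * (diagonal fun i => (d i : ℂ)) * Wᴴ := by
  obtain ⟨W, hW, d, hd, rfl⟩ := hA.1.exists_unitary_diagonal
  refine ⟨W, hW, d, hd, ?_, rfl⟩
  have h := hA.2
  rw [mul_assoc, trace_mul_comm, mul_assoc, ← star_eq_conjTranspose, mem_unitaryGroup_iff'.1 hW,
    mul_one, trace_diagonal] at h
  exact_mod_cast h

theorem entropy_nonneg {A : Matrix ι ι ℂ} (hA : IsDensity A) : 0 ≤ entropy A := by
  obtain ⟨W, hW, d, hd, hs, rfl⟩ := hA.exists_unitary_diagonal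
  rw [entropy_conj_diagonal hW]
  refine Finset.sum_nonneg fun i _ => negMulLog_nonneg (hd i) ?_
  rw [← hs]
  exact Finset.single_le_sum (fun j _ => hd j) (Finset.mem_univ i)

theorem IsDensity.kronecker {A : Matrix ι ι ℂ} {B : Matrix κ κ ℂ} (hA : IsDensity A)
    (hB : IsDensity B) : IsDensity (A ⊗ₖ B) :=
  ⟨hA.1.kronecker hB.1, by rw [trace_kronecker, hA.2, hB.2, mul_one]⟩

theorem entropy_kronecker {A : Matrix ι ι ℂ} {B : Matrix κ κ ℂ} (hA : IsDensity A)
    (hB : IsDensity B) : entropy (A ⊗ₖ B) = entropy A + entropy B := by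
  obtain ⟨W, hW, d, hd, hs, rfl⟩ := hA.exists_unitary_diagonal
  obtain ⟨W', hW', d', hd', hs', rfl⟩ := hB.exists_unitary_diagonal
  rw [entropy_conj_diagonal hW, entropy_conj_diagonal hW', mul_kronecker_mul, mul_kronecker_mul,
    ← conjTranspose_kronecker, diagonal_kronecker_diagonal]
  have h := entropy_conj_diagonal (kronecker_mem_unitary hW hW')
    (fun x : ι × κ => d x.1 * d' x.2)
  push_cast at h
  rw [h, Fintype.sum_prod_type]
  simp_rw [negMulLog_mul, Finset.sum_add_distrib, ← Finset.sum_mul, ← Finset.mul_sum,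
    ← Finset.sum_mul, hs, hs', one_mul]

/-- The diagonal of a positive matrix in any orthonormal basis has entropy at least that of the
matrix. -/
theorem entropy_le_sum_diag {A U : Matrix ι ι ℂ} (hA : A.PosSemidef)
    (hU : U ∈ unitaryGroup ι ℂ) :
    entropy A ≤ ∑ j, negMulLog ((Uᴴ * A * U) j j).re := by
  obtain ⟨W, hW, d, hd, rfl⟩ := hA.exists_unitary_diagonal
  rw [entropy_conj_diagonal hW]
  -- The squared moduli of the entries of this unitary form a doubly stochastic matrix carrying the
  -- spectrum to the diagonal; Jensen's inequality then uses the row sums, and the column sums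
  -- restore the entropy.
  set M : Matrix ι ι ℂ := Uᴴ * W with hM
  have hMu : M ∈ unitaryGroup ι ℂ := mul_mem (Unitary.star_mem hU) hW
  have hent : ∀ j, ((Uᴴ * (W * (diagonal fun i => (d i : ℂ)) * Wᴴ) * U) j j).re =
      ∑ k, Complex.normSq (M j k) * d k := by
    intro j
    have : Uᴴ * (W * (diagonal fun i => (d i : ℂ)) * Wᴴ) * U =
        M * (diagonal fun i => (d i : ℂ)) * Mᴴ := by
      simp [hM, conjTranspose_mul, mul_assoc]
    rw [this, mul_apply, Complex.re_sum]
    refine Finset.sum_congr rfl fun k _ => ?_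
    rw [mul_diagonal, conjTranspose_apply]
    simp [Complex.normSq_apply]
    ring
  have hrow : ∀ j, ∑ k, Complex.normSq (M j k) = 1 := by
    intro j
    have h := congrFun₂ (mem_unitaryGroup_iff.1 hMu) j j
    rw [mul_apply, one_apply_eq] at h
    have h' := congrArg Complex.re h
    simpa [star_eq_conjTranspose, conjTranspose_apply, Complex.normSq_apply] using h'
  have hcol : ∀ k, ∑ j, Complex.normSq (M j k) = 1 := by
    intro k
    have h := congrFun₂ (mem_unitaryGroup_iff'.1 hMu) k k
    rw [mul_apply, one_apply_eq] at h
    have h' := congrArg Complex.re h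
    simpa [star_eq_conjTranspose, conjTranspose_apply, Complex.normSq_apply] using h'
  calc ∑ k, negMulLog (d k) = ∑ j, ∑ k, Complex.normSq (M j k) * negMulLog (d k) := by
        rw [Finset.sum_comm]
        simp_rw [← Finset.sum_mul, hcol, one_mul]
    _ ≤ _ := by
        refine Finset.sum_le_sum fun j _ => ?_
        rw [hent]
        exact concaveOn_negMulLog.le_map_sum (fun k _ => Complex.normSq_nonneg _) (hrow j)
          (fun k _ => hd k)

/-- In an eigenbasis of the mixture its eigenvalues are mixtures of the diagonals of `A` and `B`.
Scalar concavity applies entrywise, and passing from a matrix to its diagonal does not lower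
entropy. -/
theorem entropy_concave {A B : Matrix ι ι ℂ} (hA : A.PosSemidef) (hB : B.PosSemidef) {a b : ℝ}
    (ha : 0 ≤ a) (hb : 0 ≤ b) (hab : a + b = 1) :
    a * entropy A + b * entropy B ≤ entropy ((a : ℂ) • A + (b : ℂ) • B) := by
  have hC : ((a : ℂ) • A + (b : ℂ) • B).PosSemidef :=
    (hA.smul (by exact_mod_cast ha)).add (hB.smul (by exact_mod_cast hb))
  obtain ⟨U, hU, d, hd, hUd⟩ := hC.exists_unitary_diagonal
  have hdiag : ∀ j, d j = a * ((Uᴴ * A * U) j j).re + b * ((Uᴴ * B * U) j j).re := by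
    intro j
    have h1 : Uᴴ * ((a : ℂ) • A + (b : ℂ) • B) * U = diagonal fun i => (d i : ℂ) := by
      have hUU : Uᴴ * U = 1 := mem_unitaryGroup_iff'.1 hU
      rw [hUd, ← mul_assoc, ← mul_assoc, hUU, one_mul, mul_assoc, hUU, mul_one]
    have h2 := congrArg Complex.re (congrFun₂ h1 j j)
    simp only [mul_add, add_mul, Matrix.mul_smul, Matrix.smul_mul, Matrix.add_apply,
      Matrix.smul_apply, smul_eq_mul, Complex.add_re, Complex.re_ofReal_mul, diagonal_apply_eq, Complex.ofReal_re] at h2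
    exact h2.symm
  have hpos : ∀ {C : Matrix ι ι ℂ}, C.PosSemidef → ∀ j, 0 ≤ ((Uᴴ * C * U) j j).re := by
    intro C hC j
    exact (Complex.nonneg_iff.1 ((hC.conjTranspose_mul_mul_same U).diag_nonneg (i := j))).1
  rw [hUd, entropy_conj_diagonal hU]
  calc _ ≤ a * ∑ j, negMulLog ((Uᴴ * A * U) j j).re
        + b * ∑ j, negMulLog ((Uᴴ * B * U) j j).re := by
        gcongr
        · exact entropy_le_sum_diag hA hU
        · exact entropy_le_sum_diag hB hU
    _ = ∑ j, (a * negMulLog ((Uᴴ * A * U) j j).re + b * negMulLog ((Uᴴ * B * U) j j).re) := by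
        rw [Finset.sum_add_distrib, Finset.mul_sum, Finset.mul_sum]
    _ ≤ _ := by
        refine Finset.sum_le_sum fun j _ => ?_
        rw [hdiag j]
        exact concaveOn_negMulLog.2 (hpos hA j) (hpos hB j) ha hb hab

theorem isDensity_single (i : ι) : IsDensity (single i i (1 : ℂ)) := by
  refine ⟨?_, by simp⟩
  have := posSemidef_vecMulVec_self_star (Pi.single i (1 : ℂ))
  convert this using 1
  ext a b
  simp [vecMulVec_apply, single_apply, Pi.single_apply]
  grind

/-- The maximally mixed state. -/
noncomputable def maxMixed (ι : Type*) [Fintype ι] [DecidableEq ι] : Matrix ι ι ℂ :=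
  ((Fintype.card ι : ℂ)⁻¹) • 1

theorem isDensity_maxMixed [Nonempty ι] : IsDensity (maxMixed ι) := by
  refine ⟨PosSemidef.one.smul (by positivity), ?_⟩
  simp [maxMixed, trace_smul]

theorem entropy_maxMixed [Nonempty ι] : entropy (maxMixed ι) = log (Fintype.card ι) := by
  have : maxMixed ι = diagonal fun _ => (((Fintype.card ι : ℝ)⁻¹ : ℝ) : ℂ) := by
    simp [maxMixed, smul_one_eq_diagonal]
  rw [this, entropy_diagonal]
  simp [negMulLog]

theorem entropy_single (i : ι) : entropy (single i i (1 : ℂ)) = 0 := by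
  have : single i i (1 : ℂ) = diagonal fun j => ((if j = i then 1 else 0 : ℝ) : ℂ) := by
    ext a b
    by_cases hab : a = b
    · subst hab
      by_cases ha : a = i
      · simp [ha]
      · simp [ha, Ne.symm ha]
    · simp only [single_apply, diagonal_apply, hab, if_false]
      grind
  rw [this, entropy_diagonal]
  refine Finset.sum_eq_zero fun j _ => ?_
  split_ifs <;> simp

theorem exists_smul_density [Nonempty ι] {X : Matrix ι ι ℂ} (hX : X.PosSemidef) :
    ∃ t : ℝ, 0 ≤ t ∧ ∃ ρ, IsDensity ρ ∧ X = (t : ℂ) • ρ := by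
  obtain ⟨h1, h2⟩ := Complex.nonneg_iff.1 hX.trace_nonneg
  have htr : X.trace = (X.trace.re : ℂ) := Complex.ext (by simp) (by simp [← h2])
  rcases h1.eq_or_lt with h | h
  · refine ⟨0, le_rfl, maxMixed ι, isDensity_maxMixed, ?_⟩
    rw [← h, Complex.ofReal_zero, hX.trace_eq_zero_iff] at htr
    simp [htr]
  · refine ⟨X.trace.re, h.le, ((X.trace.re)⁻¹ : ℂ) • X, ⟨hX.smul ?_, ?_⟩, ?_⟩
    · exact_mod_cast (inv_pos.2 h).le
    · rw [trace_smul, smul_eq_mul]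
      nth_rw 2 [htr]
      exact inv_mul_cancel₀ (by exact_mod_cast h.ne')
    · rw [smul_smul, mul_inv_cancel₀ (by exact_mod_cast h.ne'), one_smul]

/-- `X` is a nonnegative multiple of a density operator of entropy at least `m`. -/
def EntropyGE (m : ℝ) (X : Matrix ι ι ℂ) : Prop :=
  ∃ t : ℝ, 0 ≤ t ∧ ∃ ρ, IsDensity ρ ∧ m ≤ entropy ρ ∧ X = (t : ℂ) • ρ

theorem EntropyGE.le_entropy {m : ℝ} {X : Matrix ι ι ℂ} (h : EntropyGE m X)
    (hX : X.trace = 1) : m ≤ entropy X := by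
  obtain ⟨t, ht, ρ, hρ, hm, rfl⟩ := h
  rw [trace_smul, hρ.2, smul_eq_mul, mul_one] at hX
  simpa [hX] using hm

/-- This is concavity for unnormalized operators: a sum of branches inherits a lower bound common to
the normalized branches. -/
theorem EntropyGE.add {m : ℝ} {X Y : Matrix ι ι ℂ} (hX : EntropyGE m X) (hY : EntropyGE m Y) :
    EntropyGE m (X + Y) := by
  obtain ⟨t, ht, ρ, hρ, hm, rfl⟩ := hX
  obtain ⟨s, hs, σ, hσ, hm', rfl⟩ := hY
  rcases (add_nonneg ht hs).eq_or_lt with h | h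
  -- Zero total weight cannot be normalized, but then the sum is zero and either state serves.
  · obtain rfl : t = 0 := by linarith
    obtain rfl : s = 0 := by linarith
    exact ⟨0, le_rfl, ρ, hρ, hm, by simp⟩
  · have hab : t / (t + s) + s / (t + s) = 1 := by field_simp
    have ha : 0 ≤ t / (t + s) := by positivity
    have hb : 0 ≤ s / (t + s) := by positivity
    refine ⟨t + s, h.le, ((t / (t + s) : ℝ) : ℂ) • ρ + ((s / (t + s) : ℝ) : ℂ) • σ,
      ⟨?_, ?_⟩, ?_, ?_⟩
    · exact (hρ.1.smul (by exact_mod_cast ha)).add (hσ.1.smul (by exact_mod_cast hb))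
    · rw [trace_add, trace_smul, trace_smul, hρ.2, hσ.2]
      simp only [smul_eq_mul, mul_one]
      exact_mod_cast hab
    · refine le_trans ?_ (entropy_concave hρ.1 hσ.1 ha hb hab)
      calc m = t / (t + s) * m + s / (t + s) * m := by rw [← add_mul, hab, one_mul]
        _ ≤ _ := by gcongr
    · rw [smul_add, smul_smul, smul_smul, ← Complex.ofReal_mul, ← Complex.ofReal_mul,
        mul_div_cancel₀ _ h.ne', mul_div_cancel₀ _ h.ne']

/-- Nonemptiness matters: for the empty sum some state of entropy at least `m` would still have to
exist. -/
theorem EntropyGE.sum {α : Type*} [Fintype α] [Nonempty α] {m : ℝ} {X : α → Matrix ι ι ℂ}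
    (h : ∀ i, EntropyGE m (X i)) : EntropyGE m (∑ i, X i) :=
  Finset.sum_induction_nonempty X (EntropyGE m) (fun _ _ => EntropyGE.add)
    Finset.univ_nonempty fun i _ => h i

theorem EntropyGE.kronecker {m : ℝ} {X : Matrix ι ι ℂ} (hX : EntropyGE m X) {σ : Matrix κ κ ℂ}
    (hσ : IsDensity σ) : EntropyGE (m + entropy σ) (X ⊗ₖ σ) := by
  obtain ⟨t, ht, ρ, hρ, hm, rfl⟩ := hX
  exact ⟨t, ht, _, hρ.kronecker hσ, by rw [entropy_kronecker hρ hσ]; linarith, smul_kronecker _ _ _⟩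

theorem EntropyGE.kronecker_left {m : ℝ} {X : Matrix ι ι ℂ} (hX : EntropyGE m X)
    {σ : Matrix κ κ ℂ} (hσ : IsDensity σ) : EntropyGE (entropy σ + m) (σ ⊗ₖ X) := by
  obtain ⟨t, ht, ρ, hρ, hm, rfl⟩ := hX
  exact ⟨t, ht, _, hσ.kronecker hρ, by rw [entropy_kronecker hσ hρ]; linarith, kronecker_smul _ _ _⟩

theorem EntropyGE.mono {m m' : ℝ} {X : Matrix ι ι ℂ} (hX : EntropyGE m X) (h : m' ≤ m) :
    EntropyGE m' X := by
  obtain ⟨t, ht, ρ, hρ, hm, rfl⟩ := hX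
  exact ⟨t, ht, ρ, hρ, h.trans hm, rfl⟩

theorem _root_.Matrix.PosSemidef.entropyGE_zero [Nonempty ι] {X : Matrix ι ι ℂ}
    (hX : X.PosSemidef) : EntropyGE 0 X := by
  obtain ⟨t, ht, ρ, hρ, rfl⟩ := exists_smul_density hX
  exact ⟨t, ht, ρ, hρ, entropy_nonneg hρ, rfl⟩

end Entropy

/-! ### Kraus representations, channels and their minimum output entropy. -/

section Maps

variable {ι κ ι' κ' μ μ' : Type*} [Fintype ι] [DecidableEq ι] [Fintype κ] [DecidableEq κ]
  [Fintype ι'] [DecidableEq ι'] [Fintype κ'] [DecidableEq κ'] [Fintype μ] [DecidableEq μ]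
  [Fintype μ'] [DecidableEq μ']

/-- The completely positive map `X ↦ A X A*`. -/
def conjBy (A : Matrix κ ι ℂ) : Matrix ι ι ℂ →ₗ[ℂ] Matrix κ κ ℂ where
  toFun X := A * X * Aᴴ
  map_add' X Y := by rw [Matrix.mul_add, Matrix.add_mul]
  map_smul' c X := by simp

@[simp] theorem conjBy_apply (A : Matrix κ ι ℂ) (X : Matrix ι ι ℂ) :
    conjBy A X = A * X * Aᴴ := rfl

theorem conjBy_comp (A : Matrix μ κ ℂ) (B : Matrix κ ι ℂ) :
    conjBy A ∘ₗ conjBy B = conjBy (A * B) := by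
  ext1 X
  simp [conjTranspose_mul, Matrix.mul_assoc]

@[simp] theorem conjBy_one : conjBy (1 : Matrix ι ι ℂ) = LinearMap.id := by
  ext1 X
  simp

theorem conjBy_submatrix_one (f : ι → ι') (X : Matrix ι' ι' ℂ) :
    conjBy ((1 : Matrix ι' ι' ℂ).submatrix f id) X = X.submatrix f f := by
  ext a b
  simp [mul_apply, one_apply]

/-- The map `Y ↦ Y ⊗ σ` adjoining a system in the state `σ`. -/
def attach (ι : Type*) [Fintype ι] [DecidableEq ι] (σ : Matrix κ κ ℂ) :
    Matrix ι ι ℂ →ₗ[ℂ] Matrix (ι × κ) (ι × κ) ℂ where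
  toFun X := X ⊗ₖ σ
  map_add' X Y := add_kronecker X Y σ
  map_smul' c X := smul_kronecker c X σ

@[simp] theorem attach_apply (σ : Matrix κ κ ℂ) (X : Matrix ι ι ℂ) :
    attach ι σ X = X ⊗ₖ σ := rfl

/-- Linear maps on operators of a tensor product agree if they agree on product operators. -/
theorem kronecker_ext {M : Type*} [AddCommMonoid M] [Module ℂ M]
    {F G : Matrix (ι × ι') (ι × ι') ℂ →ₗ[ℂ] M}
    (h : ∀ (X : Matrix ι ι ℂ) (Y : Matrix ι' ι' ℂ), F (X ⊗ₖ Y) = G (X ⊗ₖ Y)) : F = G := by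
  have : F ∘ₗ (kroneckerLinearEquiv ι ι ι' ι' ℂ).toLinearMap =
      G ∘ₗ (kroneckerLinearEquiv ι ι ι' ι' ℂ).toLinearMap :=
    TensorProduct.ext' fun X Y => by simpa using h X Y
  exact (LinearMap.cancel_right (kroneckerLinearEquiv ι ι ι' ι' ℂ).surjective).1 this

theorem tensor_comp (Φ : Matrix ι ι ℂ →ₗ[ℂ] Matrix κ κ ℂ) (Ψ : Matrix ι' ι' ℂ →ₗ[ℂ] Matrix κ' κ' ℂ)
    (Φ' : Matrix κ κ ℂ →ₗ[ℂ] Matrix μ μ ℂ) (Ψ' : Matrix κ' κ' ℂ →ₗ[ℂ] Matrix μ' μ' ℂ) :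
    tensor (Φ' ∘ₗ Φ) (Ψ' ∘ₗ Ψ) = tensor Φ' Ψ' ∘ₗ tensor Φ Ψ :=
  kronecker_ext fun X Y => by simp [tensor_kronecker]

theorem tensor_conjBy (A : Matrix κ ι ℂ) (B : Matrix κ' ι' ℂ) :
    tensor (conjBy A) (conjBy B) = conjBy (A ⊗ₖ B) :=
  kronecker_ext fun X Y => by
    simp only [tensor_kronecker, conjBy_apply, mul_kronecker_mul, conjTranspose_kronecker]

theorem tensor_sum_left {α : Type*} [Fintype α] (Φ : α → Matrix ι ι ℂ →ₗ[ℂ] Matrix κ κ ℂ)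
    (Ψ : Matrix ι' ι' ℂ →ₗ[ℂ] Matrix κ' κ' ℂ) :
    tensor (∑ a, Φ a) Ψ = ∑ a, tensor (Φ a) Ψ :=
  kronecker_ext fun X Y => by
    simp only [tensor_kronecker, LinearMap.sum_apply]
    exact map_sum (attach κ (Ψ Y)) _ _

theorem tensor_sum_right {α : Type*} [Fintype α] (Φ : Matrix ι ι ℂ →ₗ[ℂ] Matrix κ κ ℂ)
    (Ψ : α → Matrix ι' ι' ℂ →ₗ[ℂ] Matrix κ' κ' ℂ) :
    tensor Φ (∑ a, Ψ a) = ∑ a, tensor Φ (Ψ a) :=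
  kronecker_ext fun X Y => by
    simp only [tensor_kronecker, LinearMap.sum_apply]
    exact map_sum (kroneckerBilinear (R := ℂ) (Φ X)) _ _

theorem tensor_smul_left (c : ℂ) (Φ : Matrix ι ι ℂ →ₗ[ℂ] Matrix κ κ ℂ)
    (Ψ : Matrix ι' ι' ℂ →ₗ[ℂ] Matrix κ' κ' ℂ) :
    tensor (c • Φ) Ψ = c • tensor Φ Ψ :=
  kronecker_ext fun X Y => by simp [tensor_kronecker, smul_kronecker]

theorem tensor_smul_right (c : ℂ) (Φ : Matrix ι ι ℂ →ₗ[ℂ] Matrix κ κ ℂ)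
    (Ψ : Matrix ι' ι' ℂ →ₗ[ℂ] Matrix κ' κ' ℂ) :
    tensor Φ (c • Ψ) = c • tensor Φ Ψ :=
  kronecker_ext fun X Y => by simp [tensor_kronecker, kronecker_smul]

/-- A linear map with an operator-sum (Kraus) representation. -/
def IsKraus (Φ : Matrix ι ι ℂ →ₗ[ℂ] Matrix κ κ ℂ) : Prop :=
  ∃ (n : ℕ) (K : Fin n → Matrix κ ι ℂ), Φ = ∑ e, conjBy (K e)

theorem IsKraus.of_fintype {α : Type*} [Fintype α] {Φ : Matrix ι ι ℂ →ₗ[ℂ] Matrix κ κ ℂ}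
    (K : α → Matrix κ ι ℂ) (h : Φ = ∑ e, conjBy (K e)) : IsKraus Φ :=
  ⟨Fintype.card α, fun i => K ((Fintype.equivFin α).symm i), by
    rw [h]; exact ((Fintype.equivFin α).symm.sum_comp fun e => conjBy (K e)).symm⟩

theorem isKraus_conjBy (A : Matrix κ ι ℂ) : IsKraus (conjBy A) :=
  .of_fintype (fun _ : Unit => A) (by simp)

theorem IsKraus.add {Φ Ψ : Matrix ι ι ℂ →ₗ[ℂ] Matrix κ κ ℂ} (hΦ : IsKraus Φ) (hΨ : IsKraus Ψ) :
    IsKraus (Φ + Ψ) := by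
  obtain ⟨n, K, rfl⟩ := hΦ
  obtain ⟨m, L, rfl⟩ := hΨ
  exact .of_fintype (Sum.elim K L) (by simp)

theorem IsKraus.comp {Φ : Matrix ι ι ℂ →ₗ[ℂ] Matrix κ κ ℂ} {Ψ : Matrix κ κ ℂ →ₗ[ℂ] Matrix μ μ ℂ}
    (hΨ : IsKraus Ψ) (hΦ : IsKraus Φ) : IsKraus (Ψ ∘ₗ Φ) := by
  obtain ⟨n, K, rfl⟩ := hΦ
  obtain ⟨m, L, rfl⟩ := hΨ
  refine .of_fintype (fun x : Fin m × Fin n => L x.1 * K x.2) ?_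
  ext1 X
  simp only [Fintype.sum_prod_type, ← conjBy_comp, LinearMap.comp_apply, LinearMap.sum_apply,
    map_sum]
  exact Finset.sum_comm

theorem IsKraus.tensor {Φ : Matrix ι ι ℂ →ₗ[ℂ] Matrix κ κ ℂ}
    {Ψ : Matrix ι' ι' ℂ →ₗ[ℂ] Matrix κ' κ' ℂ} (hΦ : IsKraus Φ) (hΨ : IsKraus Ψ) :
    IsKraus (tensor Φ Ψ) := by
  obtain ⟨n, K, rfl⟩ := hΦ
  obtain ⟨m, L, rfl⟩ := hΨ
  refine .of_fintype (fun x : Fin n × Fin m => K x.1 ⊗ₖ L x.2) ?_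
  simp only [Fintype.sum_prod_type, ← tensor_conjBy, tensor_sum_left]
  simp only [tensor_sum_right]

theorem IsKraus.posSemidef {Φ : Matrix ι ι ℂ →ₗ[ℂ] Matrix κ κ ℂ} (hΦ : IsKraus Φ)
    {X : Matrix ι ι ℂ} (hX : X.PosSemidef) : (Φ X).PosSemidef := by
  obtain ⟨n, K, rfl⟩ := hΦ
  rw [LinearMap.sum_apply]
  exact posSemidef_sum _ fun e _ => hX.mul_mul_conjTranspose_same (K e)

theorem _root_.Matrix.PosSemidef.exists_eq_conjTranspose_mul_self {A : Matrix ι ι ℂ}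
    (hA : A.PosSemidef) : ∃ B : Matrix ι ι ℂ, A = Bᴴ * B := by
  obtain ⟨W, -, d, hd, rfl⟩ := hA.exists_unitary_diagonal
  refine ⟨(diagonal fun i => ((√(d i) : ℝ) : ℂ)) * Wᴴ, ?_⟩
  have hsq : (diagonal fun i => (d i : ℂ)) =
      (diagonal fun i => ((√(d i) : ℝ) : ℂ)) * diagonal fun i => ((√(d i) : ℝ) : ℂ) := by
    rw [diagonal_mul_diagonal]
    simp_rw [← Complex.ofReal_mul, mul_self_sqrt (hd _)]
  rw [conjTranspose_mul, conjTranspose_conjTranspose, (isHermitian_diagonal_ofReal _).eq, hsq]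
  simp only [mul_assoc]

/-- Factor σ as B* B; each row of B contributes one Kraus operator, which tensors its argument with
the conjugate of that row. -/
theorem isKraus_attach {σ : Matrix κ κ ℂ} (hσ : σ.PosSemidef) : IsKraus (attach ι σ) := by
  obtain ⟨B, rfl⟩ := hσ.exists_eq_conjTranspose_mul_self
  refine .of_fintype (fun (k : κ) => Matrix.of fun (x : ι × κ) (i : ι) =>
    if x.1 = i then star (B k x.2) else 0) ?_
  ext1 X
  ext ⟨i, a⟩ ⟨j, b⟩
  simp [mul_apply, Matrix.sum_apply, Finset.mul_sum, apply_ite]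
  refine Finset.sum_congr rfl fun k _ => ?_
  ring

/-- Choi's theorem. -/
theorem IsCompletelyPositive.isKraus {Φ : Matrix ι ι ℂ →ₗ[ℂ] Matrix κ κ ℂ}
    (h : IsCompletelyPositive Φ) : IsKraus Φ := by
  classical
  set f := Fintype.equivFin ι
  -- The unnormalized maximally entangled vector; the image of its projector is the Choi matrix. The
  -- bijection `f` is needed because complete positivity is tested on ancillas `Fin n`.
  set v : Fin (Fintype.card ι) × ι → ℂ := fun x => if x.1 = f x.2 then 1 else 0 with hv
  have hC := h _ _ (posSemidef_vecMulVec_self_star v)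
  have hX : vecMulVec v (star v) =
      ∑ i, ∑ j, single (f i) (f j) (1 : ℂ) ⊗ₖ single i j (1 : ℂ) := by
    ext ⟨a, i⟩ ⟨b, j⟩
    simp [vecMulVec_apply, hv, Matrix.sum_apply, single_apply, kroneckerMap_apply, ite_and]
    grind
  have hCe : ∀ i j k l, QuantumChannel.tensor (LinearMap.id) Φ (vecMulVec v (star v)) (f i, k) (f j, l) =
      Φ (single i j 1) k l := by
    intro i j k l
    rw [hX]
    simp only [map_sum, tensor_kronecker, Matrix.sum_apply, kroneckerMap_apply, LinearMap.id_apply,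
      single_apply]
    rw [Finset.sum_eq_single i, Finset.sum_eq_single j]
    · simp
    · intro b _ hb; simp [hb]
    · simp
    · intro b _ hb; simp [hb]
    · simp
  obtain ⟨B, hB⟩ := hC.exists_eq_conjTranspose_mul_self
  -- Each row of the factor of the Choi matrix, conjugated and reshaped, is a Kraus operator.
  refine .of_fintype (fun r => Matrix.of fun k i => star (B r (f i, k))) ?_
  refine Matrix.ext_linearMap ℂ fun i j => ?_
  ext1
  ext k l
  simp only [LinearMap.comp_apply, singleLinearMap_apply]
  rw [← hCe, hB]
  simp [mul_apply, Matrix.sum_apply, single_apply, ite_and]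

/-- A trace preserving linear map with an operator-sum representation. -/
structure IsKrausChannel (Φ : Matrix ι ι ℂ →ₗ[ℂ] Matrix κ κ ℂ) : Prop where
  isKraus : IsKraus Φ
  trace_map : ∀ X, (Φ X).trace = X.trace

theorem IsChannel.isKrausChannel {Φ : Matrix ι ι ℂ →ₗ[ℂ] Matrix κ κ ℂ} (h : IsChannel Φ) :
    IsKrausChannel Φ := ⟨h.1.isKraus, h.2⟩

theorem IsKrausChannel.isChannel {Φ : Matrix ι ι ℂ →ₗ[ℂ] Matrix κ κ ℂ} (h : IsKrausChannel Φ) :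
    IsChannel Φ :=
  ⟨fun n _ hX => ((by simpa using isKraus_conjBy (1 : Matrix (Fin n) (Fin n) ℂ) :
    IsKraus LinearMap.id).tensor h.isKraus).posSemidef hX, h.trace_map⟩

theorem IsKrausChannel.isDensity {Φ : Matrix ι ι ℂ →ₗ[ℂ] Matrix κ κ ℂ} (h : IsKrausChannel Φ)
    {ρ : Matrix ι ι ℂ} (hρ : IsDensity ρ) : IsDensity (Φ ρ) :=
  ⟨h.isKraus.posSemidef hρ.1, by rw [h.trace_map, hρ.2]⟩

theorem IsKrausChannel.tensor {Φ : Matrix ι ι ℂ →ₗ[ℂ] Matrix κ κ ℂ}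
    {Ψ : Matrix ι' ι' ℂ →ₗ[ℂ] Matrix κ' κ' ℂ} (hΦ : IsKrausChannel Φ) (hΨ : IsKrausChannel Ψ) :
    IsKrausChannel (tensor Φ Ψ) := by
  refine ⟨hΦ.isKraus.tensor hΨ.isKraus, fun X => ?_⟩
  have : traceLinearMap (κ × κ') ℂ ℂ ∘ₗ QuantumChannel.tensor Φ Ψ =
      traceLinearMap (ι × ι') ℂ ℂ :=
    kronecker_ext fun X Y => by
      simp [tensor_kronecker, trace_kronecker, hΦ.trace_map, hΨ.trace_map]
  exact LinearMap.congr_fun this X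

theorem IsKrausChannel.comp {Φ : Matrix ι ι ℂ →ₗ[ℂ] Matrix κ κ ℂ}
    {Ψ : Matrix κ κ ℂ →ₗ[ℂ] Matrix μ μ ℂ}
    (hΨ : IsKrausChannel Ψ) (hΦ : IsKrausChannel Φ) : IsKrausChannel (Ψ ∘ₗ Φ) :=
  ⟨hΨ.isKraus.comp hΦ.isKraus, fun X => by
    rw [LinearMap.comp_apply, hΨ.trace_map, hΦ.trace_map]⟩

theorem isKrausChannel_conjBy {A : Matrix κ ι ℂ} (hA : Aᴴ * A = 1) :
    IsKrausChannel (conjBy A) :=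
  ⟨isKraus_conjBy A, fun X => by
    rw [conjBy_apply, Matrix.mul_assoc, trace_mul_comm, Matrix.mul_assoc, hA, mul_one]⟩

theorem isKrausChannel_attach {σ : Matrix κ κ ℂ} (hσ : IsDensity σ) :
    IsKrausChannel (attach ι σ) :=
  ⟨isKraus_attach hσ.1, fun X => by simp [trace_kronecker, hσ.2]⟩

theorem IsKrausChannel.nonempty [Nonempty ι] {Φ : Matrix ι ι ℂ →ₗ[ℂ] Matrix κ κ ℂ}
    (hΦ : IsKrausChannel Φ) : Nonempty κ := by
  by_contra h
  rw [not_nonempty_iff] at h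
  have := (hΦ.isDensity (isDensity_maxMixed (ι := ι))).2
  simp [Matrix.trace] at this

/-- A nonempty index type supplies a density operator; otherwise the infimum would be the default
value `sInf ∅ = 0`. -/
theorem le_minOutputEntropy [Nonempty ι] {Φ : Matrix ι ι ℂ →ₗ[ℂ] Matrix κ κ ℂ} {m : ℝ}
    (h : ∀ ρ, IsDensity ρ → m ≤ entropy (Φ ρ)) : m ≤ minOutputEntropy Φ := by
  refine le_csInf ⟨_, maxMixed ι, isDensity_maxMixed, rfl⟩ ?_
  rintro _ ⟨ρ, hρ, rfl⟩
  exact h ρ hρ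

theorem IsKrausChannel.minOutputEntropy_le {Φ : Matrix ι ι ℂ →ₗ[ℂ] Matrix κ κ ℂ}
    (hΦ : IsKrausChannel Φ) {ρ : Matrix ι ι ℂ} (hρ : IsDensity ρ) :
    minOutputEntropy Φ ≤ entropy (Φ ρ) := by
  refine csInf_le ⟨0, ?_⟩ ⟨ρ, hρ, rfl⟩
  rintro _ ⟨ρ, hρ, rfl⟩
  exact entropy_nonneg (hΦ.isDensity hρ)

/-- Nearly optimal inputs suffice for the reductions, so attainment of the minimum by compactness is
never needed. -/
theorem exists_entropy_lt [Nonempty ι] (Φ : Matrix ι ι ℂ →ₗ[ℂ] Matrix κ κ ℂ) {m : ℝ}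
    (h : minOutputEntropy Φ < m) : ∃ ρ, IsDensity ρ ∧ entropy (Φ ρ) < m := by
  by_contra! hc
  exact (le_minOutputEntropy hc).not_gt h

theorem IsKrausChannel.entropyGE [Nonempty ι] {Φ : Matrix ι ι ℂ →ₗ[ℂ] Matrix κ κ ℂ}
    (hΦ : IsKrausChannel Φ) {X : Matrix ι ι ℂ} (hX : X.PosSemidef) :
    EntropyGE (minOutputEntropy Φ) (Φ X) := by
  obtain ⟨t, ht, ρ, hρ, rfl⟩ := exists_smul_density hX
  exact ⟨t, ht, Φ ρ, hΦ.isDensity hρ, hΦ.minOutputEntropy_le hρ, map_smul _ _ _⟩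

/-- The minimum output entropy is subadditive. -/
theorem IsKrausChannel.minOutputEntropy_tensor_le [Nonempty ι] [Nonempty ι']
    {Φ : Matrix ι ι ℂ →ₗ[ℂ] Matrix κ κ ℂ}
    {Ψ : Matrix ι' ι' ℂ →ₗ[ℂ] Matrix κ' κ' ℂ} (hΦ : IsKrausChannel Φ) (hΨ : IsKrausChannel Ψ) :
    minOutputEntropy (QuantumChannel.tensor Φ Ψ) ≤ minOutputEntropy Φ + minOutputEntropy Ψ := by
  have h : ∀ ρ, IsDensity ρ → ∀ σ, IsDensity σ →
      minOutputEntropy (QuantumChannel.tensor Φ Ψ) ≤ entropy (Φ ρ) + entropy (Ψ σ) := by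
    intro ρ hρ σ hσ
    refine ((hΦ.tensor hΨ).minOutputEntropy_le (hρ.kronecker hσ)).trans_eq ?_
    rw [tensor_kronecker, entropy_kronecker (hΦ.isDensity hρ) (hΨ.isDensity hσ)]
  rw [← sub_le_iff_le_add]
  refine le_minOutputEntropy fun ρ hρ => ?_
  rw [sub_le_comm]
  refine le_minOutputEntropy fun σ hσ => ?_
  linarith [h ρ hρ σ hσ]

/-- `T` changes the entropy of every density operator by the constant `s`. -/
structure ShiftsEntropy (T : Matrix ι ι ℂ →ₗ[ℂ] Matrix κ κ ℂ) (s : ℝ) : Prop where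
  isDensity : ∀ ρ, IsDensity ρ → IsDensity (T ρ)
  entropy_eq : ∀ ρ, IsDensity ρ → entropy (T ρ) = entropy ρ + s

theorem ShiftsEntropy.comp {T : Matrix ι ι ℂ →ₗ[ℂ] Matrix κ κ ℂ}
    {T' : Matrix κ κ ℂ →ₗ[ℂ] Matrix μ μ ℂ} {s s' : ℝ} (hT' : ShiftsEntropy T' s')
    (hT : ShiftsEntropy T s) : ShiftsEntropy (T' ∘ₗ T) (s + s') :=
  ⟨fun ρ hρ => hT'.isDensity _ (hT.isDensity _ hρ), fun ρ hρ => by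
    rw [LinearMap.comp_apply, hT'.entropy_eq _ (hT.isDensity _ hρ), hT.entropy_eq _ hρ, add_assoc]⟩

theorem submatrix_equiv_mem_unitaryGroup (e : κ ≃ ι) {W : Matrix ι ι ℂ}
    (hW : W ∈ unitaryGroup ι ℂ) : W.submatrix e e ∈ unitaryGroup κ ℂ := by
  rw [mem_unitaryGroup_iff'] at hW ⊢
  rw [star_eq_conjTranspose, conjTranspose_submatrix, submatrix_mul_equiv,
    ← star_eq_conjTranspose, hW, submatrix_one_equiv]

theorem IsDensity.submatrix (e : κ ≃ ι) {A : Matrix ι ι ℂ} (hA : IsDensity A) :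
    IsDensity (A.submatrix e e) :=
  ⟨hA.1.submatrix e, by
    rw [← hA.2]; exact e.sum_comp fun i => A i i⟩

theorem entropy_submatrix (e : κ ≃ ι) {A : Matrix ι ι ℂ} (hA : A.PosSemidef) :
    entropy (A.submatrix e e) = entropy A := by
  obtain ⟨W, hW, d, -, rfl⟩ := hA.exists_unitary_diagonal
  have := entropy_conj_diagonal (submatrix_equiv_mem_unitaryGroup e hW) (d ∘ e)
  rw [entropy_conj_diagonal hW, ← e.sum_comp, ← submatrix_mul_equiv _ _ e e e,
    ← submatrix_mul_equiv _ _ e e e, submatrix_diagonal_equiv]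
  exact this

/-- Attaching local states is attaching their product, up to the permutation of factors, which
preserves entropy. -/
theorem tensor_attach (σ : Matrix κ κ ℂ) (σ' : Matrix κ' κ' ℂ) (X : Matrix (ι × ι') (ι × ι') ℂ) :
    tensor (attach ι σ) (attach ι' σ') X = (X ⊗ₖ (σ ⊗ₖ σ')).submatrix
      (Equiv.prodProdProdComm ι κ ι' κ') (Equiv.prodProdProdComm ι κ ι' κ') := by
  have : tensor (attach ι σ) (attach ι' σ') =
      (reindexLinearEquiv ℂ ℂ (Equiv.prodProdProdComm ι κ ι' κ').symm
        (Equiv.prodProdProdComm ι κ ι' κ').symm).toLinearMap ∘ₗ attach _ (σ ⊗ₖ σ') :=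
    kronecker_ext fun X Y => by
      ext ⟨⟨a, b⟩, c, d⟩ ⟨⟨a', b'⟩, c', d'⟩
      simp [tensor_kronecker, kroneckerMap_apply]
      ring
  rw [this]
  rfl

theorem shiftsEntropy_tensor_attach {σ : Matrix κ κ ℂ} {σ' : Matrix κ' κ' ℂ} (hσ : IsDensity σ)
    (hσ' : IsDensity σ') :
    ShiftsEntropy (tensor (attach ι σ) (attach ι' σ')) (entropy σ + entropy σ') where
  isDensity ρ hρ := by
    rw [tensor_attach]
    exact (hρ.kronecker (hσ.kronecker hσ')).submatrix _
  entropy_eq ρ hρ := by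
    have h := hσ.kronecker hσ'
    rw [tensor_attach, entropy_submatrix _ (hρ.kronecker h).1, entropy_kronecker hρ h,
      entropy_kronecker hσ hσ']

theorem shiftsEntropy_reindex (e : ι ≃ κ) :
    ShiftsEntropy (reindexLinearEquiv ℂ ℂ e e).toLinearMap 0 where
  isDensity _ hρ := hρ.submatrix e.symm
  entropy_eq _ hρ := by
    rw [add_zero]
    exact entropy_submatrix e.symm hρ.1

/-- If `Ω` and `Ω'`, restricted to subspaces, are `Φ` and `Φ'` followed by maps that jointly add the
constant `s` to the entropy, then the minimum output entropy of `Ω ⊗ Ω'` exceeds that of `Φ ⊗ Φ'`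
by at most `s`. -/
theorem minOutputEntropy_tensor_le_of_comp {ν ν' o o' : Type*} [Fintype ν] [DecidableEq ν]
    [Fintype ν'] [DecidableEq ν'] [Fintype o] [DecidableEq o] [Fintype o'] [DecidableEq o']
    [Nonempty ι] [Nonempty ι']
    {Φ : Matrix ι ι ℂ →ₗ[ℂ] Matrix κ κ ℂ} {Φ' : Matrix ι' ι' ℂ →ₗ[ℂ] Matrix κ' κ' ℂ}
    {Ω : Matrix ν ν ℂ →ₗ[ℂ] Matrix o o ℂ} {Ω' : Matrix ν' ν' ℂ →ₗ[ℂ] Matrix o' o' ℂ}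
    (hΦ : IsKrausChannel Φ) (hΦ' : IsKrausChannel Φ') (hΩ : IsKrausChannel Ω)
    (hΩ' : IsKrausChannel Ω') {A : Matrix ν ι ℂ} {A' : Matrix ν' ι' ℂ} (hA : Aᴴ * A = 1)
    (hA' : A'ᴴ * A' = 1) {T : Matrix κ κ ℂ →ₗ[ℂ] Matrix o o ℂ}
    {T' : Matrix κ' κ' ℂ →ₗ[ℂ] Matrix o' o' ℂ} {s : ℝ} (hT : ShiftsEntropy (tensor T T') s)
    (h : Ω ∘ₗ conjBy A = T ∘ₗ Φ) (h' : Ω' ∘ₗ conjBy A' = T' ∘ₗ Φ') :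
    minOutputEntropy (tensor Ω Ω') ≤ minOutputEntropy (tensor Φ Φ') + s := by
  rw [← sub_le_iff_le_add]
  refine le_minOutputEntropy fun ρ hρ => ?_
  rw [sub_le_iff_le_add, ← hT.entropy_eq _ ((hΦ.tensor hΦ').isDensity hρ), ← LinearMap.comp_apply,
    ← tensor_comp, ← h, ← h', tensor_comp]
  exact (hΩ.tensor hΩ').minOutputEntropy_le
    (((isKrausChannel_conjBy hA).tensor (isKrausChannel_conjBy hA')).isDensity hρ)

end Maps

/-! ### Random unitary maps: controlled operations, dephasing and depolarizing. -/

section RandomUnitary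

variable {ι κ : Type*} [Fintype ι] [DecidableEq ι] [Fintype κ] [DecidableEq κ]

theorem isRandomUnitary_iff {Φ : Matrix ι ι ℂ →ₗ[ℂ] Matrix ι ι ℂ} :
    IsRandomUnitary Φ ↔ ∃ (n : ℕ) (U : Fin n → Matrix ι ι ℂ) (p : Fin n → ℝ),
      (∀ i, U i ∈ unitaryGroup ι ℂ) ∧ (∀ i, 0 ≤ p i) ∧ ∑ i, p i = 1 ∧
        Φ = ∑ i, (p i : ℂ) • conjBy (U i) := by
  simp only [IsRandomUnitary, LinearMap.ext_iff, LinearMap.sum_apply, LinearMap.smul_apply,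
    conjBy_apply]

theorem IsRandomUnitary.of_fintype {α : Type*} [Fintype α]
    {Φ : Matrix ι ι ℂ →ₗ[ℂ] Matrix ι ι ℂ} (U : α → Matrix ι ι ℂ) (p : α → ℝ)
    (hU : ∀ i, U i ∈ unitaryGroup ι ℂ) (hp : ∀ i, 0 ≤ p i) (hs : ∑ i, p i = 1)
    (h : Φ = ∑ i, (p i : ℂ) • conjBy (U i)) : IsRandomUnitary Φ := by
  set e := (Fintype.equivFin α).symm
  exact isRandomUnitary_iff.2 ⟨Fintype.card α, U ∘ e, p ∘ e, fun i => hU _, fun i => hp _,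
    (e.sum_comp p).trans hs, h.trans (e.sum_comp fun i => (p i : ℂ) • conjBy (U i)).symm⟩

theorem IsRandomUnitary.isKrausChannel {Φ : Matrix ι ι ℂ →ₗ[ℂ] Matrix ι ι ℂ}
    (h : IsRandomUnitary Φ) : IsKrausChannel Φ := by
  obtain ⟨n, U, p, hU, hp, hs, rfl⟩ := isRandomUnitary_iff.1 h
  refine ⟨⟨n, fun i => ((√(p i) : ℝ) : ℂ) • U i, ?_⟩, fun X => ?_⟩
  · refine Finset.sum_congr rfl fun i _ => ?_
    ext1 X
    simp only [LinearMap.smul_apply, conjBy_apply, conjTranspose_smul, Matrix.smul_mul,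
      Matrix.mul_smul, smul_smul]
    rw [Complex.star_def, Complex.conj_ofReal, ← Complex.ofReal_mul, mul_self_sqrt (hp i)]
  · have : ∀ i, (conjBy (U i) X).trace = X.trace := fun i =>
      (isKrausChannel_conjBy (mem_unitaryGroup_iff'.1 (hU i))).trace_map X
    simp only [LinearMap.sum_apply, LinearMap.smul_apply, trace_sum, trace_smul, this]
    rw [← Finset.sum_smul, ← Complex.ofReal_sum, hs, Complex.ofReal_one, one_smul]

theorem IsRandomUnitary.comp {Φ Ψ : Matrix ι ι ℂ →ₗ[ℂ] Matrix ι ι ℂ} (hΦ : IsRandomUnitary Φ)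
    (hΨ : IsRandomUnitary Ψ) : IsRandomUnitary (Φ ∘ₗ Ψ) := by
  obtain ⟨n, U, p, hU, hp, hs, rfl⟩ := isRandomUnitary_iff.1 hΦ
  obtain ⟨m, V, q, hV, hq, ht, rfl⟩ := isRandomUnitary_iff.1 hΨ
  refine .of_fintype (fun x : Fin n × Fin m => U x.1 * V x.2) (fun x => p x.1 * q x.2)
    (fun x => mul_mem (hU _) (hV _)) (fun x => mul_nonneg (hp _) (hq _)) ?_ ?_
  · simp [Fintype.sum_prod_type, ← Finset.mul_sum, hs, ht]
  · ext1 X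
    simp only [Fintype.sum_prod_type, ← conjBy_comp, LinearMap.comp_apply, LinearMap.sum_apply,
      map_sum, LinearMap.smul_apply, map_smul, mul_smul, Complex.ofReal_mul, Finset.smul_sum]
    rw [Finset.sum_comm]
    exact Finset.sum_congr rfl fun _ _ => Finset.sum_congr rfl fun _ _ => smul_comm _ _ _

theorem isRandomUnitary_id : IsRandomUnitary (LinearMap.id : Matrix ι ι ℂ →ₗ[ℂ] _) :=
  .of_fintype (fun _ : Unit => 1) (fun _ => 1) (fun _ => one_mem _) (fun _ => zero_le_one)
    (by simp) (by simp)

theorem IsRandomUnitary.tensor {Φ : Matrix ι ι ℂ →ₗ[ℂ] Matrix ι ι ℂ}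
    {Ψ : Matrix κ κ ℂ →ₗ[ℂ] Matrix κ κ ℂ} (hΦ : IsRandomUnitary Φ)
    (hΨ : IsRandomUnitary Ψ) : IsRandomUnitary (tensor Φ Ψ) := by
  obtain ⟨n, U, p, hU, hp, hs, rfl⟩ := isRandomUnitary_iff.1 hΦ
  obtain ⟨m, V, q, hV, hq, ht, rfl⟩ := isRandomUnitary_iff.1 hΨ
  refine .of_fintype (fun x : Fin n × Fin m => U x.1 ⊗ₖ V x.2) (fun x => p x.1 * q x.2)
    (fun x => kronecker_mem_unitary (hU _) (hV _)) (fun x => mul_nonneg (hp _) (hq _)) ?_ ?_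
  · simp [Fintype.sum_prod_type, ← Finset.mul_sum, hs, ht]
  · simp only [Fintype.sum_prod_type, ← tensor_conjBy, tensor_sum_left]
    simp only [tensor_sum_right, tensor_smul_left, tensor_smul_right, smul_smul,
      Complex.ofReal_mul, mul_comm]

/-- Measuring a projection `P` and applying one of two random unitary maps to a second system,
depending on the outcome, is random unitary. -/
theorem isRandomUnitary_controlled {P : Matrix ι ι ℂ} (hP : P.IsHermitian) (hPP : P * P = P)
    {Φ Ψ : Matrix κ κ ℂ →ₗ[ℂ] Matrix κ κ ℂ} (hΦ : IsRandomUnitary Φ) (hΨ : IsRandomUnitary Ψ) :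
    IsRandomUnitary (QuantumChannel.tensor (conjBy P) Φ +
      QuantumChannel.tensor (conjBy (1 - P)) Ψ) := by
  obtain ⟨n, U, p, hU, hp, hs, rfl⟩ := isRandomUnitary_iff.1 hΦ
  obtain ⟨m, V, q, hV, hq, ht, rfl⟩ := isRandomUnitary_iff.1 hΨ
  have hPQ : P * (1 - P) = 0 := by rw [mul_sub, hPP, mul_one, sub_self]
  have hQP : (1 - P) * P = 0 := by rw [sub_mul, hPP, one_mul, sub_self]
  have hQQ : (1 - P) * (1 - P) = 1 - P := by rw [mul_sub, hQP, mul_one, sub_zero]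
  have hQ : (1 - P).IsHermitian := isHermitian_one.sub hP
  have key : ∀ ε : ℂ, ε * star ε = 1 → ∀ i j,
      P ⊗ₖ U i + ε • ((1 - P) ⊗ₖ V j) ∈ unitaryGroup (ι × κ) ℂ := by
    intro ε hε i j
    rw [mem_unitaryGroup_iff', star_eq_conjTranspose]
    have h1 : (U i)ᴴ * U i = 1 := mem_unitaryGroup_iff'.1 (hU i)
    have h2 : (V j)ᴴ * V j = 1 := mem_unitaryGroup_iff'.1 (hV j)
    simp only [conjTranspose_add, conjTranspose_smul, conjTranspose_kronecker, hP.eq, hQ.eq,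
      add_mul, mul_add, Matrix.smul_mul, Matrix.mul_smul, ← mul_kronecker_mul, hPQ, hQP, hQQ, hPP,
      h1, h2, zero_kronecker, smul_zero, add_zero, zero_add, smul_smul, hε, one_smul]
    rw [← add_kronecker, add_sub_cancel, one_kronecker_one]
  -- A uniformly random relative sign between the two branches cancels the cross terms, which
  -- amounts to measuring `P`.
  refine .of_fintype (fun x : Bool × Fin n × Fin m =>
    P ⊗ₖ U x.2.1 + (if x.1 then (1 : ℂ) else -1) • ((1 - P) ⊗ₖ V x.2.2))
    (fun x => 1 / 2 * (p x.2.1 * q x.2.2)) (fun x => key _ (by split_ifs <;> simp) _ _)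
    (fun x => mul_nonneg (by norm_num) (mul_nonneg (hp _) (hq _))) ?_ ?_
  · simp [Fintype.sum_prod_type, ← Finset.mul_sum, hs, ht]
  · have hsum : ∀ i j (c : ℝ), ∑ b : Bool, (((1 / 2 * c : ℝ) : ℂ)) •
        conjBy (P ⊗ₖ U i + (if b then (1 : ℂ) else -1) • ((1 - P) ⊗ₖ V j)) =
        (c : ℂ) • QuantumChannel.tensor (conjBy P) (conjBy (U i)) +
        (c : ℂ) • QuantumChannel.tensor (conjBy (1 - P)) (conjBy (V j)) := by
      intro i j c
      simp only [tensor_conjBy]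
      generalize P ⊗ₖ U i = A
      generalize (1 - P) ⊗ₖ V j = B
      ext1 X
      simp only [Fintype.sum_bool, LinearMap.add_apply, LinearMap.smul_apply, conjBy_apply, if_true,
        Bool.false_eq_true, if_false, one_smul, neg_smul, conjTranspose_add, conjTranspose_neg,
        add_mul, mul_add, neg_mul, mul_neg]
      push_cast
      module
    rw [Fintype.sum_prod_type, Finset.sum_comm]
    simp_rw [hsum]
    simp only [Fintype.sum_prod_type, Finset.sum_add_distrib]
    congr 1
    · simp only [← Finset.sum_smul, ← Complex.ofReal_sum, ← Finset.mul_sum, ht, mul_one,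
        tensor_sum_right, tensor_smul_right]
    · rw [Finset.sum_comm]
      simp only [← Finset.sum_smul, ← Complex.ofReal_sum, ← Finset.sum_mul, hs, one_mul,
        tensor_sum_right, tensor_smul_right]

/-- Restriction to the diagonal. -/
def dephase (ι : Type*) [Fintype ι] [DecidableEq ι] : Matrix ι ι ℂ →ₗ[ℂ] Matrix ι ι ℂ :=
  ∑ i, conjBy (single i i 1)

theorem dephase_apply (X : Matrix ι ι ℂ) : dephase ι X = diagonal fun i => X i i := by
  ext a b
  simp [dephase, LinearMap.sum_apply, Matrix.sum_apply, single_apply, diagonal_apply,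
    ite_and]

/-- The completely depolarizing channel. -/
noncomputable def depolarize (ι : Type*) [Fintype ι] [DecidableEq ι] :
    Matrix ι ι ℂ →ₗ[ℂ] Matrix ι ι ℂ :=
  (traceLinearMap ι ℂ ℂ).smulRight (maxMixed ι)

theorem depolarize_apply (X : Matrix ι ι ℂ) : depolarize ι X = X.trace • maxMixed ι := rfl

/-- For i ≠ j, flipping the sign at i permutes the sign vectors and negates the sum. Averaging over
sign matrices thus kills off-diagonal entries. -/
theorem sum_sign_mul_sign (i j : ι) :
    ∑ s : ι → ℤˣ, ((s i : ℤ) : ℂ) * ((s j : ℤ) : ℂ) =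
      if i = j then (Fintype.card (ι → ℤˣ) : ℂ) else 0 := by
  split_ifs with h
  · subst h
    have : ∀ s : ι → ℤˣ, ((s i : ℤ) : ℂ) * ((s i : ℤ) : ℂ) = 1 := fun s => by
      rw [← Int.cast_mul, ← Units.val_mul, Int.units_mul_self]; simp
    simp [this]
  · have := Equiv.sum_comp (Equiv.mulLeft (Function.update (1 : ι → ℤˣ) i (-1)))
      fun s => ((s i : ℤ) : ℂ) * ((s j : ℤ) : ℂ)
    simp only [Equiv.coe_mulLeft, Pi.mul_apply, Function.update_self,
      Function.update_of_ne (Ne.symm h), Pi.one_apply, one_mul, Units.val_neg, neg_mul,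
      Int.cast_neg, Finset.sum_neg_distrib] at this
    exact self_eq_neg.1 this.symm

theorem isRandomUnitary_dephase : IsRandomUnitary (dephase ι) := by
  refine .of_fintype (fun s : ι → ℤˣ => diagonal fun i => ((s i : ℤ) : ℂ))
    (fun _ => (Fintype.card (ι → ℤˣ) : ℝ)⁻¹) (fun s => ?_) (fun _ => by positivity) ?_ ?_
  · rw [mem_unitaryGroup_iff', star_eq_conjTranspose, diagonal_conjTranspose, diagonal_mul_diagonal,
      ← diagonal_one]
    congr 1
    ext i
    simp only [Pi.star_apply, Complex.star_def, map_intCast]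
    rw [← Int.cast_mul, ← Units.val_mul, Int.units_mul_self]; simp
  · simp
  · ext1 X
    ext i j
    rw [dephase_apply]
    simp only [LinearMap.sum_apply, LinearMap.smul_apply, conjBy_apply, Matrix.sum_apply,
      Matrix.smul_apply, diagonal_conjTranspose, mul_diagonal, diagonal_mul, Pi.star_apply,
      Complex.star_def, map_intCast, smul_eq_mul, ← Finset.mul_sum]
    have : ∀ s : ι → ℤˣ, ((s i : ℤ) : ℂ) * X i j * ((s j : ℤ) : ℂ) =
        ((s i : ℤ) : ℂ) * ((s j : ℤ) : ℂ) * X i j := fun s => by ring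
    simp_rw [this, ← Finset.sum_mul, sum_sign_mul_sign, diagonal_apply]
    split_ifs with h
    · subst h
      simp
    · simp

theorem permMatrix_mem_unitaryGroup (σ : Equiv.Perm ι) :
    (1 : Matrix ι ι ℂ).submatrix σ id ∈ unitaryGroup ι ℂ := by
  rw [mem_unitaryGroup_iff, star_eq_conjTranspose, conjTranspose_submatrix, conjTranspose_one,
    ← submatrix_mul _ _ _ id _ Function.bijective_id, mul_one, submatrix_one_equiv]

/-- Dephasing leaves only the diagonal, and uniformly random translations of the group spread each
diagonal entry evenly over all positions. -/
theorem isRandomUnitary_depolarize [AddCommGroup ι] : IsRandomUnitary (depolarize ι) := by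
  have h : IsRandomUnitary (∑ g : ι, (((Fintype.card ι : ℝ)⁻¹ : ℝ) : ℂ) •
      conjBy ((1 : Matrix ι ι ℂ).submatrix (Equiv.addRight g) id)) :=
    .of_fintype _ (fun _ => (Fintype.card ι : ℝ)⁻¹) (fun g => permMatrix_mem_unitaryGroup _)
      (fun _ => by positivity) (by simp) rfl
  convert h.comp isRandomUnitary_dephase using 1
  ext1 X
  ext i j
  simp only [LinearMap.comp_apply, LinearMap.sum_apply, LinearMap.smul_apply, conjBy_submatrix_one,
    dephase_apply, depolarize_apply, Matrix.sum_apply, Matrix.smul_apply, submatrix_apply,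
    diagonal_apply, maxMixed, one_apply, smul_eq_mul, ← Finset.mul_sum]
  simp only [Equiv.coe_addRight, add_left_inj]
  split_ifs with h
  · have := Equiv.sum_comp (Equiv.addLeft i) fun k => X k k
    simp only [Equiv.coe_addLeft] at this
    simp [this, Matrix.trace, mul_comm]
  · simp

end RandomUnitary

/-! ### The two reductions: direct sums and random unitary extensions. -/

section Reductions

variable {ι κ ι' κ' : Type*} [Fintype ι] [DecidableEq ι] [Fintype κ] [DecidableEq κ]
  [Fintype ι'] [DecidableEq ι'] [Fintype κ'] [DecidableEq κ']

theorem tensor_reindex (e : ι ≃ κ) (e' : ι' ≃ κ') :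
    tensor (reindexLinearEquiv ℂ ℂ e e).toLinearMap (reindexLinearEquiv ℂ ℂ e' e').toLinearMap =
      (reindexLinearEquiv ℂ ℂ (e.prodCongr e') (e.prodCongr e')).toLinearMap :=
  kronecker_ext fun X Y => by
    rw [tensor_kronecker]
    ext ⟨a, b⟩ ⟨c, d⟩
    simp [kroneckerMap_apply]

theorem reindex_eq_conjBy (e : ι ≃ κ) :
    (reindexLinearEquiv ℂ ℂ e e).toLinearMap =
      conjBy ((1 : Matrix ι ι ℂ).submatrix e.symm id) := by
  ext1 X
  ext a b
  simp [mul_apply, one_apply]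

/-- The map `Y ↦ σ ⊗ Y`. -/
noncomputable def attachLeft (ι : Type*) [Fintype ι] [DecidableEq ι] (σ : Matrix κ κ ℂ) :
    Matrix ι ι ℂ →ₗ[ℂ] Matrix (κ × ι) (κ × ι) ℂ :=
  (reindexLinearEquiv ℂ ℂ (Equiv.prodComm ι κ) (Equiv.prodComm ι κ)).toLinearMap ∘ₗ attach ι σ

theorem attachLeft_apply (σ : Matrix κ κ ℂ) (X : Matrix ι ι ℂ) : attachLeft ι σ X = σ ⊗ₖ X := by
  ext ⟨a, b⟩ ⟨c, d⟩
  simp [attachLeft, kroneckerMap_apply, mul_comm]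

theorem isKrausChannel_attachLeft {σ : Matrix κ κ ℂ} (hσ : IsDensity σ) :
    IsKrausChannel (attachLeft ι σ) := by
  rw [attachLeft, reindex_eq_conjBy]
  refine .comp (isKrausChannel_conjBy ?_) (isKrausChannel_attach hσ)
  rw [conjTranspose_submatrix, conjTranspose_one, submatrix_mul_equiv, mul_one]
  simp

theorem shiftsEntropy_tensor_attach_attachLeft {σ : Matrix κ κ ℂ} {σ' : Matrix κ' κ' ℂ}
    (hσ : IsDensity σ) (hσ' : IsDensity σ') :
    ShiftsEntropy (tensor (attach ι σ) (attachLeft ι' σ')) (entropy σ + entropy σ') := by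
  have h : tensor (attach ι σ) (attachLeft ι' σ') =
      tensor (reindexLinearEquiv ℂ ℂ (Equiv.refl (ι × κ)) (Equiv.refl _)).toLinearMap
        (reindexLinearEquiv ℂ ℂ (Equiv.prodComm ι' κ') (Equiv.prodComm ι' κ')).toLinearMap ∘ₗ
      tensor (attach ι σ) (attach ι' σ') := by
    rw [← tensor_comp]
    rfl
  rw [h, tensor_reindex, ← add_zero (entropy σ + entropy σ')]
  exact (shiftsEntropy_reindex _).comp (shiftsEntropy_tensor_attach hσ hσ')

/-- The direct sum of `X ↦ Φ X ⊗ σ` and `Y ↦ σ' ⊗ Ψ Y`. -/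
noncomputable def directSum (Φ : Matrix ι ι ℂ →ₗ[ℂ] Matrix κ κ ℂ)
    (Ψ : Matrix ι' ι' ℂ →ₗ[ℂ] Matrix κ' κ' ℂ) (σ : Matrix κ' κ' ℂ) (σ' : Matrix κ κ ℂ) :
    Matrix (ι ⊕ ι') (ι ⊕ ι') ℂ →ₗ[ℂ] Matrix (κ × κ') (κ × κ') ℂ :=
  attach κ σ ∘ₗ Φ ∘ₗ conjBy ((1 : Matrix (ι ⊕ ι') (ι ⊕ ι') ℂ).submatrix Sum.inl id) +
    attachLeft κ' σ' ∘ₗ Ψ ∘ₗ conjBy ((1 : Matrix (ι ⊕ ι') (ι ⊕ ι') ℂ).submatrix Sum.inr id)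

theorem isKrausChannel_directSum {Φ : Matrix ι ι ℂ →ₗ[ℂ] Matrix κ κ ℂ}
    {Ψ : Matrix ι' ι' ℂ →ₗ[ℂ] Matrix κ' κ' ℂ} (hΦ : IsKrausChannel Φ) (hΨ : IsKrausChannel Ψ)
    {σ : Matrix κ' κ' ℂ} {σ' : Matrix κ κ ℂ} (hσ : IsDensity σ) (hσ' : IsDensity σ') :
    IsKrausChannel (directSum Φ Ψ σ σ') := by
  refine ⟨.add ?_ ?_, fun X => ?_⟩
  · exact (isKraus_attach hσ.1).comp (hΦ.isKraus.comp (isKraus_conjBy _))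
  · exact (isKrausChannel_attachLeft hσ').isKraus.comp (hΨ.isKraus.comp (isKraus_conjBy _))
  · simp only [directSum, LinearMap.add_apply, LinearMap.comp_apply, conjBy_submatrix_one,
      trace_add, (isKrausChannel_attach hσ).trace_map, (isKrausChannel_attachLeft hσ').trace_map,
      hΦ.trace_map, hΨ.trace_map]
    simp [Matrix.trace]

/-- Off-diagonal blocks are discarded. In each remaining branch one factor is a multiple of a
channel output and the other a fixed output, so both tensor factors meet their minimum output
entropy bound. -/
theorem le_minOutputEntropy_directSum [Nonempty ι] [Nonempty ι']
    {Φ : Matrix ι ι ℂ →ₗ[ℂ] Matrix κ κ ℂ}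
    {Ψ : Matrix ι' ι' ℂ →ₗ[ℂ] Matrix κ' κ' ℂ} (hΦ : IsKrausChannel Φ) (hΨ : IsKrausChannel Ψ)
    {σ : Matrix ι' ι' ℂ} {σ' : Matrix ι ι ℂ} (hσ : IsDensity σ) (hσ' : IsDensity σ') :
    minOutputEntropy Φ + minOutputEntropy Ψ ≤ minOutputEntropy (directSum Φ Ψ (Ψ σ) (Φ σ')) := by
  have hD := isKrausChannel_directSum hΦ hΨ (hΨ.isDensity hσ) (hΦ.isDensity hσ')
  refine le_minOutputEntropy fun ρ hρ => EntropyGE.le_entropy ?_ (hD.isDensity hρ).2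
  simp only [directSum, LinearMap.add_apply, LinearMap.comp_apply, conjBy_submatrix_one,
    attach_apply, attachLeft_apply]
  refine .add ?_ ?_
  · refine ((hΦ.entropyGE (hρ.1.submatrix _)).kronecker (hΨ.isDensity hσ)).mono ?_
    have := hΨ.minOutputEntropy_le hσ
    linarith
  · refine ((hΨ.entropyGE (hρ.1.submatrix _)).kronecker_left (hΦ.isDensity hσ')).mono ?_
    have := hΦ.minOutputEntropy_le hσ'
    linarith

theorem minOutputEntropy_tensor_directSum_le [Nonempty ι] [Nonempty ι']
    {Φ : Matrix ι ι ℂ →ₗ[ℂ] Matrix κ κ ℂ}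
    {Ψ : Matrix ι' ι' ℂ →ₗ[ℂ] Matrix κ' κ' ℂ} (hΦ : IsKrausChannel Φ) (hΨ : IsKrausChannel Ψ)
    {σ : Matrix κ' κ' ℂ} {σ' : Matrix κ κ ℂ} (hσ : IsDensity σ) (hσ' : IsDensity σ') :
    minOutputEntropy (tensor (directSum Φ Ψ σ σ') (directSum Φ Ψ σ σ')) ≤
      minOutputEntropy (tensor Φ Ψ) + (entropy σ + entropy σ') := by
  have hD := isKrausChannel_directSum hΦ hΨ hσ hσ'
  -- The first copy receives inputs in the left summand, the second copy in the right one.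
  refine minOutputEntropy_tensor_le_of_comp (A := (1 : Matrix (ι ⊕ ι') (ι ⊕ ι') ℂ).submatrix id
    Sum.inl) (A' := (1 : Matrix (ι ⊕ ι') (ι ⊕ ι') ℂ).submatrix id Sum.inr) hΦ hΨ hD hD ?_ ?_
    (shiftsEntropy_tensor_attach_attachLeft hσ hσ') ?_ ?_
  · ext a b
    simp [mul_apply, one_apply]
  · ext a b
    simp [mul_apply, one_apply]
  · ext1 X
    simp only [directSum, LinearMap.add_apply, LinearMap.comp_apply, conjBy_submatrix_one]
    have h1 : (conjBy ((1 : Matrix (ι ⊕ ι') (ι ⊕ ι') ℂ).submatrix id Sum.inl) X).submatrix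
        Sum.inl Sum.inl = X := by
      ext a b
      simp [mul_apply, one_apply]
    have h2 : (conjBy ((1 : Matrix (ι ⊕ ι') (ι ⊕ ι') ℂ).submatrix id Sum.inl) X).submatrix
        Sum.inr Sum.inr = 0 := by
      ext a b
      simp [mul_apply, one_apply]
    rw [h1, h2, map_zero, map_zero, add_zero]
  · ext1 X
    simp only [directSum, LinearMap.add_apply, LinearMap.comp_apply, conjBy_submatrix_one]
    have h1 : (conjBy ((1 : Matrix (ι ⊕ ι') (ι ⊕ ι') ℂ).submatrix id Sum.inr) X).submatrix
        Sum.inr Sum.inr = X := by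
      ext a b
      simp [mul_apply, one_apply]
    have h2 : (conjBy ((1 : Matrix (ι ⊕ ι') (ι ⊕ ι') ℂ).submatrix id Sum.inr) X).submatrix
        Sum.inl Sum.inl = 0 := by
      ext a b
      simp [mul_apply, one_apply]
    rw [h1, h2, map_zero, map_zero, zero_add]

/-- Superadditivity for pairs of equal channels implies superadditivity for all pairs. -/
theorem superadditive_of_equal_pairs
    (h : ∀ (ι κ : Type) [Fintype ι] [DecidableEq ι] [Nonempty ι] [Fintype κ] [DecidableEq κ]
      (Φ : Matrix ι ι ℂ →ₗ[ℂ] Matrix κ κ ℂ), IsKrausChannel Φ →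
      2 * minOutputEntropy Φ ≤ minOutputEntropy (tensor Φ Φ))
    {ι κ ι' κ' : Type} [Fintype ι] [DecidableEq ι] [Nonempty ι] [Fintype κ] [DecidableEq κ]
    [Fintype ι'] [DecidableEq ι'] [Nonempty ι'] [Fintype κ'] [DecidableEq κ']
    {Φ : Matrix ι ι ℂ →ₗ[ℂ] Matrix κ κ ℂ} {Ψ : Matrix ι' ι' ℂ →ₗ[ℂ] Matrix κ' κ' ℂ}
    (hΦ : IsKrausChannel Φ) (hΨ : IsKrausChannel Ψ) :
    minOutputEntropy Φ + minOutputEntropy Ψ ≤ minOutputEntropy (tensor Φ Ψ) := by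
  refine le_of_forall_pos_le_add fun ε hε => ?_
  obtain ⟨ρ, hρ, hρε⟩ := exists_entropy_lt Φ (lt_add_of_pos_right (minOutputEntropy Φ) (half_pos hε))
  obtain ⟨σ, hσ, hσε⟩ := exists_entropy_lt Ψ (lt_add_of_pos_right (minOutputEntropy Ψ) (half_pos hε))
  have hσ' := hΨ.isDensity hσ
  have hρ' := hΦ.isDensity hρ
  have h1 := le_minOutputEntropy_directSum hΦ hΨ hσ hρ
  have h2 := minOutputEntropy_tensor_directSum_le hΦ hΨ hσ' hρ'
  have h3 := h _ _ _ (isKrausChannel_directSum hΦ hΨ hσ' hρ')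
  linarith

/-- The partial trace over the second factor. -/
def partialTrace (ι κ : Type*) [Fintype κ] :
    Matrix (ι × κ) (ι × κ) ℂ →ₗ[ℂ] Matrix ι ι ℂ where
  toFun X := of fun i j => ∑ k, X (i, k) (j, k)
  map_add' X Y := by ext; simp [Finset.sum_add_distrib]
  map_smul' c X := by ext; simp [Finset.mul_sum]

theorem partialTrace_apply (X : Matrix (ι × κ) (ι × κ) ℂ) (i j : ι) :
    partialTrace ι κ X i j = ∑ k, X (i, k) (j, k) := rfl

theorem partialTrace_kronecker (X : Matrix ι ι ℂ) (Y : Matrix κ κ ℂ) :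
    partialTrace ι κ (X ⊗ₖ Y) = Y.trace • X := by
  ext i j
  simp [partialTrace_apply, Matrix.trace, ← Finset.mul_sum, mul_comm]

theorem posSemidef_partialTrace {X : Matrix (ι × κ) (ι × κ) ℂ} (hX : X.PosSemidef) :
    (partialTrace ι κ X).PosSemidef := by
  have : partialTrace ι κ X = ∑ k, X.submatrix (fun i => (i, k)) fun i => (i, k) := by
    ext i j
    simp [partialTrace_apply, Matrix.sum_apply]
  rw [this]
  exact posSemidef_sum _ fun k _ => hX.submatrix _

theorem tensor_id_depolarize : tensor (LinearMap.id : Matrix ι ι ℂ →ₗ[ℂ] _) (depolarize κ) =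
    attach ι (maxMixed κ) ∘ₗ partialTrace ι κ :=
  kronecker_ext fun X Y => by
    simp [tensor_kronecker, depolarize_apply, partialTrace_kronecker, kronecker_smul]

/-- The diagonal block at position `b` of an operator on a tensor product. -/
def diagBlock (ι : Type*) {κ : Type*} (b : κ) :
    Matrix (ι × κ) (ι × κ) ℂ →ₗ[ℂ] Matrix ι ι ℂ where
  toFun X := X.submatrix (fun i => (i, b)) fun i => (i, b)
  map_add' _ _ := rfl
  map_smul' _ _ := rfl

theorem diagBlock_apply (b : κ) (X : Matrix (ι × κ) (ι × κ) ℂ) :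
    diagBlock ι b X = X.submatrix (fun i => (i, b)) fun i => (i, b) := rfl

theorem diagBlock_kronecker (b : κ) (X : Matrix ι ι ℂ) (Y : Matrix κ κ ℂ) :
    diagBlock ι b (X ⊗ₖ Y) = Y b b • X := by
  ext i j
  simp [diagBlock_apply, mul_comm]

/-- Projecting the second factor onto a basis vector selects one diagonal block; this makes the
dephased ancilla a classical register. -/
theorem tensor_conjBy_single (Φ : Matrix ι ι ℂ →ₗ[ℂ] Matrix κ κ ℂ) (b : ι') :
    tensor Φ (conjBy (single b b 1)) = attach κ (single b b 1) ∘ₗ Φ ∘ₗ diagBlock ι b :=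
  kronecker_ext fun X Y => by
    have : single b b (1 : ℂ) * Y * (single b b (1 : ℂ))ᴴ = Y b b • single b b 1 := by
      simp
    rw [tensor_kronecker, conjBy_apply, this, LinearMap.comp_apply, LinearMap.comp_apply,
      diagBlock_kronecker, map_smul, attach_apply, smul_kronecker, kronecker_smul]

/-- The random unitary map associated with an isometry `V` into `κ ⊗ ε`: on `κ ⊗ ε ⊗ β`, measure
whether the first two factors are in the range of `V`; if so, dephase `β`, otherwise depolarize it;
finally depolarize `ε`. -/
noncomputable def randomUnitaryExtension {ε : Type*} [Fintype ε] [DecidableEq ε]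
    (V : Matrix (κ × ε) ι ℂ) (β : Type*) [Fintype β] [DecidableEq β] :
    Matrix ((κ × ε) × β) ((κ × ε) × β) ℂ →ₗ[ℂ] Matrix ((κ × ε) × β) ((κ × ε) × β) ℂ :=
  tensor (tensor LinearMap.id (depolarize ε)) LinearMap.id ∘ₗ
    (tensor (conjBy (V * Vᴴ)) (dephase β) + tensor (conjBy (1 - V * Vᴴ)) (depolarize β))

/-! ### The random unitary extension of a channel given by an isometry. -/

section Extension

variable {ε β : Type*} [Fintype ε] [DecidableEq ε] [Fintype β] [DecidableEq β]

theorem isRandomUnitary_extension [AddCommGroup ε] [AddCommGroup β] {V : Matrix (κ × ε) ι ℂ}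
    (hV : Vᴴ * V = 1) : IsRandomUnitary (randomUnitaryExtension V β) := by
  refine .comp ((isRandomUnitary_id.tensor isRandomUnitary_depolarize).tensor isRandomUnitary_id)
    (isRandomUnitary_controlled (isHermitian_mul_conjTranspose_self V) ?_ isRandomUnitary_dephase
      isRandomUnitary_depolarize)
  rw [Matrix.mul_assoc, ← Matrix.mul_assoc Vᴴ, hV, Matrix.one_mul]

/-- The output splits into one success branch for each value of the dephased register and a single
failure branch. -/
theorem randomUnitaryExtension_eq {V : Matrix (κ × ε) ι ℂ} :
    randomUnitaryExtension V β =
      ∑ b, attach (κ × ε) (single b b 1) ∘ₗ (attach κ (maxMixed ε) ∘ₗ partialTrace κ ε ∘ₗ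
          conjBy (V * Vᴴ)) ∘ₗ diagBlock (κ × ε) b +
        attach (κ × ε) (maxMixed β) ∘ₗ attach κ (maxMixed ε) ∘ₗ partialTrace κ ε ∘ₗ
          partialTrace (κ × ε) β ∘ₗ tensor (conjBy (1 - V * Vᴴ)) LinearMap.id := by
  rw [randomUnitaryExtension, LinearMap.comp_add, ← tensor_comp, ← tensor_comp,
    tensor_id_depolarize, LinearMap.id_comp, LinearMap.id_comp, dephase, tensor_sum_right]
  congr 1
  · simp only [tensor_conjBy_single, LinearMap.comp_assoc]
  · refine kronecker_ext fun X Y => ?_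
    simp [tensor_kronecker, partialTrace_kronecker, depolarize_apply, kronecker_smul]

theorem le_minOutputEntropy_extension [Nonempty ι] [Nonempty κ] [Nonempty ε] [Nonempty β]
    {Φ : Matrix ι ι ℂ →ₗ[ℂ] Matrix κ κ ℂ} (hΦ : IsKrausChannel Φ) {V : Matrix (κ × ε) ι ℂ}
    (hΦV : ∀ X, Φ X = partialTrace κ ε (conjBy V X))
    (hΩ : IsKrausChannel (randomUnitaryExtension V β))
    (hβ : minOutputEntropy Φ ≤ log (Fintype.card β)) :
    minOutputEntropy Φ + log (Fintype.card ε) ≤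
      minOutputEntropy (randomUnitaryExtension V β) := by
  refine le_minOutputEntropy fun ρ hρ => EntropyGE.le_entropy ?_ (hΩ.isDensity hρ).2
  rw [randomUnitaryExtension_eq, LinearMap.add_apply, LinearMap.sum_apply]
  refine .add (.sum fun b => ?_) ?_
  -- With P = V V*, the block ρ_b satisfies P ρ_b P = V (V* ρ_b V) V*, whose partial trace is Φ(V*
  -- ρ_b V).
  · rw [← conjBy_comp]
    simp only [LinearMap.comp_apply, ← hΦV]
    have h := ((hΦ.entropyGE ((hρ.1.submatrix (fun i => (i, b))).mul_mul_conjTranspose_same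
      Vᴴ)).kronecker (isDensity_maxMixed (ι := ε))).kronecker (isDensity_single b)
    rw [entropy_maxMixed, entropy_single, add_zero] at h
    exact h
  -- On failure only nonnegativity of entropy is known for the first factor; the maximally mixed
  -- ancilla β makes up for it through `hβ`.
  · have hpos : ((QuantumChannel.tensor (conjBy (1 - V * Vᴴ)) (LinearMap.id :
        Matrix β β ℂ →ₗ[ℂ] _)) ρ).PosSemidef := by
      rw [← conjBy_one, tensor_conjBy]
      exact hρ.1.mul_mul_conjTranspose_same _
    have h := ((posSemidef_partialTrace (posSemidef_partialTrace hpos)).entropyGE_zero.kronecker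
      (isDensity_maxMixed (ι := ε))).kronecker (isDensity_maxMixed (ι := β))
    rw [entropy_maxMixed, entropy_maxMixed] at h
    exact h.mono (by linarith)

theorem minOutputEntropy_tensor_extension_le [Nonempty ι] [Nonempty ε] [Nonempty β]
    {Φ : Matrix ι ι ℂ →ₗ[ℂ] Matrix κ κ ℂ} (hΦ : IsKrausChannel Φ) {V : Matrix (κ × ε) ι ℂ}
    (hV : Vᴴ * V = 1) (hΦV : ∀ X, Φ X = partialTrace κ ε (conjBy V X))
    (hΩ : IsKrausChannel (randomUnitaryExtension V β)) :
    minOutputEntropy (tensor (randomUnitaryExtension V β) (randomUnitaryExtension V β)) ≤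
      minOutputEntropy (tensor Φ Φ) + 2 * log (Fintype.card ε) := by
  obtain ⟨b⟩ := ‹Nonempty β›
  -- The encoding ψ ↦ Vψ ⊗ |b⟩ lies in the range of V V* ⊗ 1, so only the success branch acts, and
  -- dephasing fixes |b⟩⟨b|.
  set A : Matrix ((κ × ε) × β) ι ℂ := of fun x i => if x.2 = b then V x.1 i else 0 with hA
  have hAA : Aᴴ * A = 1 := by
    rw [← hV]
    ext i j
    simp [mul_apply, hA, Fintype.sum_prod_type]
  have hAV : conjBy A = attach (κ × ε) (single b b 1) ∘ₗ conjBy V := by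
    ext1 X
    ext ⟨x, c⟩ ⟨y, d⟩
    by_cases hc : c = b <;> by_cases hd : d = b <;>
      simp [mul_apply, hA, hc, hd, eq_comm (a := b)]
  have hP : V * Vᴴ * V = V := by rw [Matrix.mul_assoc, hV, Matrix.mul_one]
  have hQ : (1 - V * Vᴴ) * V = 0 := by rw [Matrix.sub_mul, hP, Matrix.one_mul, sub_self]
  have hcomp : randomUnitaryExtension V β ∘ₗ conjBy A =
      (attach (κ × ε) (single b b 1) ∘ₗ attach κ (maxMixed ε)) ∘ₗ Φ := by
    ext1 X
    have h1 : conjBy (V * Vᴴ) (conjBy V X) = conjBy V X := by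
      rw [← LinearMap.comp_apply, conjBy_comp, hP]
    have h2 : conjBy (1 - V * Vᴴ) (conjBy V X) = 0 := by
      rw [← LinearMap.comp_apply, conjBy_comp, hQ]; simp
    have h3 : dephase β (single b b 1) = single b b 1 := by
      rw [dephase_apply]
      ext i j
      simp [single_apply, diagonal_apply]
      grind
    rw [hAV, randomUnitaryExtension, tensor_id_depolarize]
    simp only [LinearMap.comp_apply, LinearMap.add_apply, attach_apply, tensor_kronecker,
      LinearMap.id_apply, h1, h2, h3, hΦV, zero_kronecker, add_zero]
  have hT := (shiftsEntropy_tensor_attach (ι := κ × ε) (ι' := κ × ε) (isDensity_single b)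
    (isDensity_single b)).comp (shiftsEntropy_tensor_attach (ι := κ) (ι' := κ)
      (isDensity_maxMixed (ι := ε)) (isDensity_maxMixed (ι := ε)))
  rw [← tensor_comp] at hT
  refine (minOutputEntropy_tensor_le_of_comp hΦ hΦ hΩ hΩ hAA hAA hT hcomp hcomp).trans_eq ?_
  rw [entropy_maxMixed, entropy_single]
  ring

end Extension

/-- Superadditivity for squares of random unitary maps implies superadditivity for squares of
channels. -/
theorem superadditive_of_randomUnitary
    (h : ∀ (ι : Type) [Fintype ι] [DecidableEq ι] [Nonempty ι]
      (Φ : Matrix ι ι ℂ →ₗ[ℂ] Matrix ι ι ℂ), IsRandomUnitary Φ →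
      2 * minOutputEntropy Φ ≤ minOutputEntropy (tensor Φ Φ))
    {ι κ : Type} [Fintype ι] [DecidableEq ι] [Nonempty ι] [Fintype κ] [DecidableEq κ]
    {Φ : Matrix ι ι ℂ →ₗ[ℂ] Matrix κ κ ℂ} (hΦ : IsKrausChannel Φ) :
    2 * minOutputEntropy Φ ≤ minOutputEntropy (tensor Φ Φ) := by
  have := hΦ.nonempty
  obtain ⟨n, K, hK⟩ := hΦ.isKraus
  -- With no Kraus operators Φ would vanish, contradicting trace preservation. `NeZero n` gives the
  -- environment `Fin n` the cyclic group structure used for depolarizing.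
  have hn : NeZero n := ⟨by
    rintro rfl
    have := hΦ.trace_map (maxMixed ι)
    rw [isDensity_maxMixed.2, hK] at this
    simp at this⟩
  set V : Matrix (κ × Fin n) ι ℂ := of fun x i => K x.2 x.1 i with hVdef
  have hΦV : ∀ X, Φ X = partialTrace κ (Fin n) (conjBy V X) := by
    intro X
    ext k l
    simp [hK, partialTrace_apply, LinearMap.sum_apply, Matrix.sum_apply, hVdef, mul_apply]
  have hV : Vᴴ * V = 1 := by
    -- Trace preservation says tr(V* V X) = tr X for every X, which forces V* V = 1.
    refine ext_iff_trace_mul_right.2 fun X => ?_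
    have h1 := hΦ.trace_map X
    have h2 : (partialTrace κ (Fin n) (conjBy V X)).trace = (conjBy V X).trace := by
      simp [Matrix.trace, partialTrace_apply, Fintype.sum_prod_type]
    rw [hΦV, h2, conjBy_apply, Matrix.mul_assoc, trace_mul_comm, Matrix.mul_assoc,
      trace_mul_comm] at h1
    rw [h1, one_mul]
  -- The ancilla is chosen so large that its maximally mixed state has entropy at least S_min(Φ).
  obtain ⟨L, hL⟩ := exists_nat_gt (rexp (minOutputEntropy Φ))
  have hβ : minOutputEntropy Φ ≤ log (Fintype.card (Fin (L + 1))) := by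
    rw [le_log_iff_exp_le (by simp; positivity)]
    refine hL.le.trans ?_
    simp
  have hΩ : IsRandomUnitary (randomUnitaryExtension V (Fin (L + 1))) := isRandomUnitary_extension hV
  have h1 := le_minOutputEntropy_extension hΦ hΦV hΩ.isKrausChannel hβ
  have h2 := minOutputEntropy_tensor_extension_le hΦ hV hΦV hΩ.isKrausChannel
  have h3 := h _ _ hΩ
  linarith

end Reductions

end QuantumChannel

theorem mainTheorem2 :
    (∀ (ι κ ι' κ' : Type) [Fintype ι] [DecidableEq ι] [Nonempty ι] [Fintype κ] [DecidableEq κ]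
        [Fintype ι'] [DecidableEq ι'] [Nonempty ι'] [Fintype κ'] [DecidableEq κ']
        (Φ : Matrix ι ι ℂ →ₗ[ℂ] Matrix κ κ ℂ) (Ψ : Matrix ι' ι' ℂ →ₗ[ℂ] Matrix κ' κ' ℂ),
        QuantumChannel.IsChannel Φ → QuantumChannel.IsChannel Ψ →
        QuantumChannel.minOutputEntropy (QuantumChannel.tensor Φ Ψ) =
          QuantumChannel.minOutputEntropy Φ + QuantumChannel.minOutputEntropy Ψ) ↔
    (∀ (ι : Type) [Fintype ι] [DecidableEq ι] [Nonempty ι]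
        (Φ : Matrix ι ι ℂ →ₗ[ℂ] Matrix ι ι ℂ),
        QuantumChannel.IsRandomUnitary Φ →
        QuantumChannel.minOutputEntropy (QuantumChannel.tensor Φ Φ) =
          2 * QuantumChannel.minOutputEntropy Φ) := by
  constructor
  · intro h ι _ _ _ Φ hΦ
    have hc := hΦ.isKrausChannel.isChannel
    rw [h ι ι ι ι Φ Φ hc hc, two_mul]
  · intro h ι κ ι' κ' _ _ _ _ _ _ _ _ _ _ Φ Ψ hΦ hΨ
    refine le_antisymm (hΦ.isKrausChannel.minOutputEntropy_tensor_le hΨ.isKrausChannel) ?_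
    refine QuantumChannel.superadditive_of_equal_pairs ?_ hΦ.isKrausChannel hΨ.isKrausChannel
    intro ι κ _ _ _ _ _ Φ hΦ
    exact QuantumChannel.superadditive_of_randomUnitary (fun ι _ _ _ Φ hΦ => (h ι Φ hΦ).ge) hΦ
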